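/- **Setting.** Let $d\ge 1$, let $\overline B_r=\{z\in\mathbb R^d: |z_i|\le r\ \forall i\}$, let $\beta\in(0,\infty]$ and $\kappa\in(0,\infty]$, let $\xi\in\mathbb R^p$ be a random vector with law $P_\xi$, and let $F(w,\xi)$ be Borel measurable on $\overline B_\kappa\times\mathbb R^p$, continuous in $w\in\overline B_\kappa$ for every $\xi$, integrable in $\xi$, and such that for almost every $\xi$, $|F(w,\xi)-F(w',\xi)|\le L_0(\xi)\|w-w'\|_2$ for all $w,w'\in\overline B_\kappa$, where $L_0(\xi)$ is measurable, $L_0:=\mathbb E[L_0(\xi)]>0$ and $Q:=\mathbb E[L_0(\xi)^2]<\infty$. Put $f(w)=\mathbb E[F(w,\xi)]$ and, for $\alpha>0$, $f_\alpha(w)=\mathbb E[f(w+u)]$ with $u$ uniformly distributed on $\overline B_{\alpha/2}$, where it is assumed that $\kappa>\beta+\frac{\alpha}{2}$ (or $\kappa=\infty$, in which case $\beta=\infty$ is allowed). Let $S\subseteq\mathbb R^d$ be closed, $w^1\in S\cap\overline B_\beta$, and let $N(w,S\cap\overline B_\beta)$ be the Mordukhovich normal cone. Let $\overline\partial_{\epsilon}f(w)=\operatorname{co}\{\overline\partial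 f(x):\|x-w\|_2\le\epsilon\}$ be the Clarke $\epsilon$-subdifferential, and $\widehat\alpha=\sqrt d\,\frac{\alpha}{2}$. **Algorithm (SPA).** Input $w^1,\eta,K,M$. Draw $R$ uniformly from $\{2,\dots,K+1\}$. For $k=1,\dots,R-1$, draw independent samples $u^{k,i}\sim u$, $\xi^{k,i}\sim P_\xi$, $i=1,\dots,M$ (all independent, also of $R$), and let $w^{k+1}$ be the point given by a Borel measurable selection of the Euclidean projection onto $S\cap\overline B_\beta$ at $w^k-\frac{\eta}{M}\sum_{i=1}^M g^{k,i}$, where in setting (1) $g^{k,i}=\alpha^{-1}dF(w^k,u^{k,i},\xi^{k,i})$, the vector $dF(w,u,\xi)$ having $j$-th entry the difference of the values of $F(\cdot,\xi)$ at the two points obtained from $w+u$ by replacing its $j$-th coordinate by $w_j+\frac{\alpha}{2}$ and $w_j-\frac{\alpha}{2}$; in setting (2) $g^{k,i}=\widetilde\nabla F(w^k+u^{k,i},\xi^{k,i})$, where $\widetilde\nabla F$ is Borel measurable on $\overline B_{\beta+\alpha/2}\times\mathbb R^p$ and, for every $w\in\overline B_\beta$, $\widetilde\nabla F(w+u,\xi)=\nabla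 F(w+u,\xi)$ for almost every $(u,\xi)$. The output is $w^R$. Each evaluation of a $g^{k,i}$ is a gradient call. Let $\upsilon=d$ in setting (1) and $\upsilon=1$ in setting (2). **Criteria.** A random point $\overline w$ is an expected $(\epsilon_1,\epsilon_2)$-stationary point if $|f_\alpha(w)-f(w)|\le\epsilon_1$ for all $w\in\overline B_\beta$ and $\mathbb E[\operatorname{dist}(0,\nabla f_\alpha(\overline w)+N(\overline w,S\cap\overline B_\beta))]\le\epsilon_2$; it is an expected $(\epsilon_3,\epsilon_4)$-stationary point if $\widehat\alpha\le\epsilon_3$ and $\mathbb E[\operatorname{dist}(0,\overline\partial_{\widehat\alpha}f(\overline w)+N(\overline w,S\cap\overline B_\beta))]\le\epsilon_4$. **Statement.** Let $\rho>1$, $\eta=\frac{\alpha}{3\rho\sqrt d L_0}$, $C_1=\frac{2(1+3\rho)}{\rho-1}+3\rho$, $C_2=\frac{2(1+3\rho)}{\rho-1}+3$ (these are the constants of the convergence bound for $\tau=0$), and let $\Delta>0$ satisfy $\Delta\ge f_\alpha(w^1)-f_\alpha(w)$ for all $w\in S\cap\overline B_\beta$. For all $\epsilon_1,\epsilon_2>0$,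 SPA run with $$\alpha=\frac{\epsilon_1}{L_0\sqrt{d/12}},\qquad K=\left\lceil C_1\sqrt{\tfrac43}\,\frac{dL_0^2\Delta}{\epsilon_1\epsilon_2^2}\right\rceil,\qquad M=\left\lceil C_2\frac{2\upsilon Q}{\epsilon_2^2}\right\rceil$$ outputs an expected $(\epsilon_1,\epsilon_2)$-stationary point. For all $\epsilon_3,\epsilon_4>0$ with $\kappa>\beta+\epsilon_3$ (or $\kappa=\infty$), SPA run with $$\alpha=\frac{2\epsilon_3}{\sqrt d},\qquad K=\left\lceil C_1\frac{2dL_0\Delta}{\epsilon_3\epsilon_4^2}\right\rceil,\qquad M=\left\lceil C_2\frac{2\upsilon Q}{\epsilon_4^2}\right\rceil$$ outputs an expected $(\epsilon_3,\epsilon_4)$-stationary point. With these choices, for fixed $\Delta$ and $\epsilon$'s ranging over a bounded set of positive numbers, every run makes $O(\epsilon_1^{-1}\epsilon_2^{-4})$, respectively $O(\epsilon_3^{-1}\epsilon_4^{-4})$, gradient calls and $O(\epsilon_1^{-1}\epsilon_2^{-2})$, respectively $O(\epsilon_3^{-1}\epsilon_4^{-2})$, projections. -/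

import Mathlib

open MeasureTheory ProbabilityTheory Filter Topology Set
open scoped ENNReal Pointwise Gradient

noncomputable section

namespace SPA

/-- `ℝᵈ` with the Euclidean norm. -/
abbrev Vec (d : ℕ) := EuclideanSpace ℝ (Fin d)

/-! ### Variational analysis -/

/-- The closed `ℓ_∞`-ball of radius `r ∈ [0, ∞]` centered at `0` (all of `ℝᵈ` if `r = ∞`). -/
def linfBall (d : ℕ) (r : ℝ≥0∞) : Set (Vec d) := {z | ∀ i, ‖z i‖ₑ ≤ r}

/-- The set of Euclidean projections of `x` onto `T`. -/
def projSet {d : ℕ} (T : Set (Vec d)) (x : Vec d) : Set (Vec d) :=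
  {y | y ∈ T ∧ ∀ z ∈ T, ‖y - x‖ ≤ ‖z - x‖}

/-- A Borel measurable selection of the projection operator onto `T`. -/
def IsProjSelection {d : ℕ} (T : Set (Vec d)) (proj : Vec d → Vec d) : Prop :=
  Measurable proj ∧ ∀ x, proj x ∈ projSet T x

/-- The Fréchet normal cone; it is empty if `w ∉ T`. -/
def frechetNormalCone {d : ℕ} (T : Set (Vec d)) (w : Vec d) : Set (Vec d) :=
  {y | w ∈ T ∧
    limsup (fun x : Vec d => ((inner ℝ y (x - w) / ‖x - w‖ : ℝ) : EReal)) (𝓝[T \ {w}] w) ≤ 0}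

/-- The Mordukhovich normal cone; it is empty if `w ∉ T`. -/
def normalCone {d : ℕ} (T : Set (Vec d)) (w : Vec d) : Set (Vec d) :=
  {y | w ∈ T ∧ ∃ x v : ℕ → Vec d, (∀ k, x k ∈ T ∧ v k ∈ frechetNormalCone T (x k)) ∧
    Tendsto x atTop (𝓝 w) ∧ Tendsto v atTop (𝓝 y)}

/-- Clarke's generalized directional derivative
`f°(x; v) = limsup_{y → x, t ↓ 0} (f (y + t v) - f y) / t`. -/
def clarkeDeriv {d : ℕ} (f : Vec d → ℝ) (x v : Vec d) : EReal :=
  limsup (fun q : Vec d × ℝ => (((f (q.1 + q.2 • v) - f q.1) / q.2 : ℝ) : EReal))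
    (𝓝 x ×ˢ 𝓝[>] (0 : ℝ))

/-- The Clarke subdifferential. -/
def clarkeSubdiff {d : ℕ} (f : Vec d → ℝ) (x : Vec d) : Set (Vec d) :=
  {g | ∀ v, ((inner ℝ g v : ℝ) : EReal) ≤ clarkeDeriv f x v}

/-- The Clarke `ε`-subdifferential `co {∂f(x) : ‖x - w‖₂ ≤ ε}`. -/
def clarkeEpsSubdiff {d : ℕ} (f : Vec d → ℝ) (ε : ℝ) (w : Vec d) : Set (Vec d) :=
  convexHull ℝ (⋃ x ∈ Metric.closedBall w ε, clarkeSubdiff f x)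

/-! ### The stochastic loss and its smoothing -/

/-- The standing assumptions on the stochastic loss `F(w, ξ)`, `ξ ∼ Pξ`, over the `ℓ_∞`-ball of
radius `κ`, with the random Lipschitz constant `L(ξ)`. -/
structure IsLipschitzLoss {d p : ℕ} (Pξ : Measure (Vec p)) (F : Vec d → Vec p → ℝ)
    (L : Vec p → ℝ) (κ : ℝ≥0∞) : Prop where
  measurable : Measurable fun q : linfBall d κ × Vec p => F q.1 q.2
  continuousOn : ∀ ξ, ContinuousOn (fun w => F w ξ) (linfBall d κ)
  integrable : ∀ w ∈ linfBall d κ, Integrable (F w) Pξ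
  measurable_const : Measurable L
  sq_integrable : Integrable (fun ξ => L ξ ^ 2) Pξ
  lipschitz : ∀ᵐ ξ ∂Pξ, ∀ w ∈ linfBall d κ, ∀ w' ∈ linfBall d κ,
    |F w ξ - F w' ξ| ≤ L ξ * ‖w - w'‖

/-- `f(w) = 𝔼[F(w, ξ)]`. -/
def expLoss {d p : ℕ} (Pξ : Measure (Vec p)) (F : Vec d → Vec p → ℝ) (w : Vec d) : ℝ :=
  ∫ ξ, F w ξ ∂Pξ

/-- The uniform distribution on the closed `ℓ_∞`-ball of radius `α / 2`. -/
def uniformBox (d : ℕ) (α : ℝ) : Measure (Vec d) :=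
  ProbabilityTheory.cond volume (linfBall d (ENNReal.ofReal (α / 2)))

/-- The randomized smoothing `f_α(w) = 𝔼[f(w + u)]`, `u` uniform on the `ℓ_∞`-ball of radius
`α / 2`. -/
def smooth {d : ℕ} (f : Vec d → ℝ) (α : ℝ) (w : Vec d) : ℝ :=
  ∫ u, f (w + u) ∂(uniformBox d α)

/-- `gradF` is a measurable version of the almost everywhere defined gradient of `F(·, ξ)`: it is
Borel measurable on the ball of radius `β + α / 2`, and for every `w` in the ball of radius `β`
it is the gradient at `w + u` for almost every `(u, ξ)`. -/
structure IsGradVersion {d p : ℕ} (Pξ : Measure (Vec p)) (F : Vec d → Vec p → ℝ) (β : ℝ≥0∞)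
    (α : ℝ) (gradF : Vec d → Vec p → Vec d) : Prop where
  measurable : Measurable
    fun q : linfBall d (β + ENNReal.ofReal (α / 2)) × Vec p => gradF q.1 q.2
  hasGradientAt : ∀ w ∈ linfBall d β, ∀ᵐ q ∂((uniformBox d α).prod Pξ),
    HasGradientAt (fun x => F x q.2) (gradF (w + q.1) q.2) (w + q.1)

/-- `x` with its `i`-th coordinate replaced by `a`. -/
def setCoord {d : ℕ} (x : Vec d) (i : Fin d) (a : ℝ) : Vec d :=
  WithLp.toLp 2 (Function.update x.ofLp i a)

/-- The finite difference function `dF(w, u, ξ)`; its `i`-th component does not depend on `u i`. -/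
def finDiff {d p : ℕ} (F : Vec d → Vec p → ℝ) (α : ℝ) (w u : Vec d) (ξ : Vec p) : Vec d :=
  WithLp.toLp 2 fun i =>
    F (setCoord (w + u) i (w i + α / 2)) ξ - F (setCoord (w + u) i (w i - α / 2)) ξ

/-! ### The stochastic projected algorithm -/

/-- The two settings of the algorithm. -/
inductive Setting where
  | zerothOrder
  | firstOrder

/-- The factor `υ`: `d` for the zeroth-order setting, `1` for the first-order setting. -/
def Setting.upsilon (d : ℕ) : Setting → ℝ
  | .zerothOrder => d
  | .firstOrder => 1

/-- A single stochastic gradient estimate. One evaluation of it is one *gradient call*. -/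
def gradEstimate {d p : ℕ} (m : Setting) (F : Vec d → Vec p → ℝ) (gradF : Vec d → Vec p → Vec d)
    (α : ℝ) (w u : Vec d) (ξ : Vec p) : Vec d :=
  match m with
  | .zerothOrder => α⁻¹ • finDiff F α w u ξ
  | .firstOrder => gradF (w + u) ξ

/-- The memory of the algorithm: the current iterate and the numbers of gradient calls and of
projections made so far. -/
structure State (d : ℕ) where
  point : Vec d
  gradCalls : ℕ
  projections : ℕ

/-- The inner loop over a mini-batch: sums the estimates `g z` and counts the evaluations of `g`. -/
def batchSum {d : ℕ} {Z : Type*} (g : Z → Vec d) (batch : List Z) : Vec d × ℕ :=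
  batch.foldl (fun acc z => (acc.1 + g z, acc.2 + 1)) (0, 0)

/-- One iteration with step size `η` and batch size `M`; `proj j` is the selection of the
projection operator that is used for the projection number `j` (counted from `0`). -/
def step {d p : ℕ} (m : Setting) (F : Vec d → Vec p → ℝ) (gradF : Vec d → Vec p → Vec d)
    (proj : ℕ → Vec d → Vec d) (α η : ℝ) {M : ℕ} (s : State d)
    (batch : Fin M → Vec d × Vec p) : State d :=
  let G := batchSum (fun z => gradEstimate m F gradF α s.point z.1 z.2) (List.ofFn batch)
  { point := proj s.projections (s.point - (η / M) • G.1)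
    gradCalls := s.gradCalls + G.2
    projections := s.projections + 1 }

/-- The random input of the algorithm: the stopping index `R` and the samples
`(u^{k,i}, ξ^{k,i})`, `k = 1, …, K`, `i = 1, …, M` (only those with `k < R` are used). -/
abbrev Seed (d p K M : ℕ) := ℕ × (Fin K → Fin M → Vec d × Vec p)

/-- The law of the random input: `R` uniform on `{2, …, K + 1}`, the `u^{k,i}` uniform on the
`ℓ_∞`-ball of radius `α / 2`, the `ξ^{k,i}` distributed as `Pξ`, all of them independent. -/
def seedLaw (d : ℕ) {p : ℕ} (α : ℝ) (Pξ : Measure (Vec p)) (K M : ℕ) : Measure (Seed d p K M) :=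
  (uniformOn (Set.Icc 2 (K + 1))).prod
    (Measure.pi fun _ : Fin K => Measure.pi fun _ : Fin M => (uniformBox d α).prod Pξ)

/-- A run of the algorithm from `w₁`: the iterations `k = 1, …, R - 1`. The output `w^R` is the
`point` of the final state. -/
def run {d p : ℕ} (m : Setting) (F : Vec d → Vec p → ℝ) (gradF : Vec d → Vec p → Vec d)
    (proj : ℕ → Vec d → Vec d) (α η : ℝ) (w₁ : Vec d) {K M : ℕ} (seed : Seed d p K M) : State d :=
  ((List.ofFn seed.2).take (seed.1 - 1)).foldl (step m F gradF proj α η) ⟨w₁, 0, 0⟩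

/-! ### Constants and convergence criteria -/

/-- The constant `C₁` for `τ = 0`. -/
def C₁ (ρ : ℝ) : ℝ := 2 * (1 + 3 * ρ) / (ρ - 1) + 3 * ρ

/-- The constant `C₂` for `τ = 0`. -/
def C₂ (ρ : ℝ) : ℝ := 4 * (1 + 3 * ρ) / (ρ - 1) * (1 / 2) + 3

/-- The step size `η`. -/
def stepSize (d : ℕ) (ρ L₀ α : ℝ) : ℝ := α / (3 * ρ * √d * L₀)

/-- The random vector `w` is an expected `(ε₁, ε₂)`-stationary point for the function `f`, the
smoothing parameter `α` and the constraint set `S ∩ linfBall d β`. The distance to the empty set is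
`∞`; existence of the gradient and measurability of the distance are part of the definition. -/
def IsExpectedStationary₁₂ {d : ℕ} {Ω : Type*} [MeasurableSpace Ω] (f : Vec d → ℝ) (α : ℝ)
    (S : Set (Vec d)) (β : ℝ≥0∞) (ε₁ ε₂ : ℝ) (P : Measure Ω) (w : Ω → Vec d) : Prop :=
  (∀ x ∈ linfBall d β, |smooth f α x - f x| ≤ ε₁) ∧
  (∀ x ∈ linfBall d β, DifferentiableAt ℝ (smooth f α) x) ∧
  AEMeasurable
    (fun ω => Metric.infEDist 0 ({∇ (smooth f α) (w ω)} + normalCone (S ∩ linfBall d β) (w ω))) P ∧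
  ∫⁻ ω, Metric.infEDist 0 ({∇ (smooth f α) (w ω)} + normalCone (S ∩ linfBall d β) (w ω)) ∂P
    ≤ ENNReal.ofReal ε₂

/-- The random vector `w` is an expected `(ε₃, ε₄)`-stationary point for the function `f`, the
smoothing parameter `α` and the constraint set `S ∩ linfBall d β`; here `√d * α / 2` is the radius
of the Clarke subdifferential. -/
def IsExpectedStationary₃₄ {d : ℕ} {Ω : Type*} [MeasurableSpace Ω] (f : Vec d → ℝ) (α : ℝ)
    (S : Set (Vec d)) (β : ℝ≥0∞) (ε₃ ε₄ : ℝ) (P : Measure Ω) (w : Ω → Vec d) : Prop :=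
  √d * (α / 2) ≤ ε₃ ∧
  AEMeasurable (fun ω => Metric.infEDist 0
    (clarkeEpsSubdiff f (√d * (α / 2)) (w ω) + normalCone (S ∩ linfBall d β) (w ω))) P ∧
  ∫⁻ ω, Metric.infEDist 0
    (clarkeEpsSubdiff f (√d * (α / 2)) (w ω) + normalCone (S ∩ linfBall d β) (w ω)) ∂P
    ≤ ENNReal.ofReal ε₄

end SPA

end

open SPA

/-! The smoothing `smooth f α` of a Lipschitz `f` is differentiable, its gradient is the mean of `∇
f (w + u)`, and by the fundamental theorem of calculus in one coordinate each partial derivative is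
a mean finite difference of `f` divided by `α` (`gradient_smooth_apply`). Hence the gradient is
Lipschitz with constant `2 * √d * L₀ / α`, and both kinds of stochastic estimates are unbiased for
it, with second moment at most `υ Q` (`integral_gradEstimateOn`, `memLp_gradEstimateOn`).

SPA is thus a projected stochastic gradient method on a smooth function over a closed, possibly
nonconvex set. The projection itself produces a normal vector at the new point, so the residual of
one step is controlled by the decrease of the function plus the squared gradient error
(`sq_infEDist_le_of_step`). The decreases telescope to at most `Δ`. The error of a mini-batch
independent of the current iterate is at most `υ Q / M` in mean square
(`lintegral_iterates_error_le`). Averaging over the random index bounds the mean squared residual by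
`C₁ L Δ / K + C₂ υ Q / M`, with `L` the Lipschitz constant of the gradient; `K` and `M` are chosen
to make each term at most `ε² / 2`, and a mean square of at most `ε²` gives a mean of at most `ε`.

The first criterion also needs `|f_α - f| ≤ L₀ 𝔼‖u‖ ≤ L₀ α √(d/12)`. The second follows because the
gradient of the smoothing is an average of gradients of `f` at distance at most `√d α / 2`, hence
lies in the closed convex Clarke `ε`-subdifferential.

The loss is only controlled on the ball of radius `κ`. The expected loss is therefore replaced by a
globally Lipschitz extension, and the estimates by versions cut off to zero; the slack in `κ > β +
α/2` ensures that nothing changes near the iterates. -/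

/-! ### Resampling one coordinate of a product of probability measures -/

/-- On a rectangle the discarded coordinate contributes total mass one and the fresh one contributes
its own factor. It serves twice: to isolate one coordinate of the smoothing variable, and to
separate a mini-batch from the iterate at which it is used. -/
theorem measurePreserving_update_pi {ι : Type*} [Fintype ι] [DecidableEq ι] {X : ι → Type*}
    [∀ i, MeasurableSpace (X i)] (μ : ∀ i, Measure (X i)) [∀ i, IsProbabilityMeasure (μ i)]
    (i : ι) :
    MeasurePreserving (fun q : (∀ j, X j) × X i => Function.update q.1 i q.2)
      ((Measure.pi μ).prod (μ i)) (Measure.pi μ) := by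
  have hm : Measurable (fun q : (∀ j, X j) × X i => Function.update q.1 i q.2) := by
    refine measurable_pi_lambda _ fun j => ?_
    by_cases h : j = i
    · subst h; simpa using measurable_snd
    · simpa [Function.update_of_ne h, Function.comp_def] using
        (measurable_pi_apply j).comp (measurable_fst (β := X i))
  refine ⟨hm, (Measure.pi_eq fun s hs => ?_).symm⟩
  rw [Measure.map_apply hm (MeasurableSet.univ_pi hs)]
  have : (fun q : (∀ j, X j) × X i => Function.update q.1 i q.2) ⁻¹' (univ.pi s)
      = (univ.pi (Function.update s i univ)) ×ˢ (s i) := by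
    ext q
    simp only [mem_preimage, Set.mem_pi, mem_univ, true_implies, mem_prod]
    constructor
    · intro h
      refine ⟨fun j => ?_, by simpa using h i⟩
      by_cases hj : j = i
      · subst hj; simp
      · simpa [Function.update_of_ne hj] using h j
    · rintro ⟨h, h'⟩ j
      by_cases hj : j = i
      · subst hj; simpa using h'
      · simpa [Function.update_of_ne hj] using h j
  rw [this, Measure.prod_prod, Measure.pi_pi, ← Finset.mul_prod_erase _ _ (Finset.mem_univ i),
    ← Finset.mul_prod_erase _ (fun j => μ j (s j)) (Finset.mem_univ i)]
  rw [Function.update_self, measure_univ, one_mul, mul_comm]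
  congr 1
  refine Finset.prod_congr rfl fun j hj => ?_
  rw [Function.update_of_ne (Finset.ne_of_mem_erase hj)]

/-! ### The uniform distribution on a box -/

/-- The uniform distribution on `[-α/2, α/2]`. -/
noncomputable def uniformSeg (α : ℝ) : Measure ℝ := cond volume (Icc (-(α / 2)) (α / 2))

theorem linfBall_ofReal (d : ℕ) {r : ℝ} (hr : 0 ≤ r) :
    linfBall d (ENNReal.ofReal r) = {z | ∀ i, |z i| ≤ r} := by
  ext z
  simp only [linfBall, mem_ofPred_eq, ← ofReal_norm, Real.norm_eq_abs]
  exact forall_congr' fun i => ENNReal.ofReal_le_ofReal_iff hr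

theorem isClosed_linfBall (d : ℕ) (r : ℝ≥0∞) : IsClosed (linfBall d r) := by
  have : linfBall d r = ⋂ i, {z : Vec d | ‖z i‖ₑ ≤ r} := by ext; simp [linfBall]
  rw [this]
  exact isClosed_iInter fun i => isClosed_le (by fun_prop) continuous_const

theorem linfBall_add {d : ℕ} {r s : ℝ≥0∞} {x y : Vec d} (hx : x ∈ linfBall d r)
    (hy : y ∈ linfBall d s) : x + y ∈ linfBall d (r + s) := fun i =>
  (enorm_add_le _ _).trans (add_le_add (hx i) (hy i))

theorem linfBall_mono {d : ℕ} {r s : ℝ≥0∞} (h : r ≤ s) : linfBall d r ⊆ linfBall d s :=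
  fun _ hx i => (hx i).trans h

theorem closedBall_subset_linfBall (d : ℕ) {r : ℝ} {x : Vec d} (hx : ‖x‖ ≤ r) :
    x ∈ linfBall d (ENNReal.ofReal r) := fun i => by
  rw [← ofReal_norm]
  exact ENNReal.ofReal_le_ofReal ((PiLp.norm_apply_le x i).trans hx)

theorem uniformSeg_isProbabilityMeasure {α : ℝ} (hα : 0 < α) :
    IsProbabilityMeasure (uniformSeg α) := by
  apply cond_isProbabilityMeasure_of_finite
  · simp [hα]
  · simp

/-- The cube is a product of segments, so the normalised restriction of Lebesgue measure factors.
This independence of the coordinates is what permits resampling one of them. -/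
theorem map_ofLp_uniformBox (d : ℕ) {α : ℝ} (hα : 0 < α) :
    (uniformBox d α).map WithLp.ofLp = Measure.pi fun _ : Fin d => uniformSeg α := by
  have := uniformSeg_isProbabilityMeasure hα
  symm
  have hbox : linfBall d (ENNReal.ofReal (α / 2)) =
      WithLp.ofLp ⁻¹' (univ.pi fun _ : Fin d => Icc (-(α / 2)) (α / 2)) := by
    rw [linfBall_ofReal d (by positivity)]
    ext z; simp only [mem_ofPred_eq, abs_le, mem_preimage, Set.mem_pi, mem_univ, true_implies, mem_Icc]
  have hvol : ∀ s : Fin d → Set ℝ, (∀ i, MeasurableSet (s i)) →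
      volume ((WithLp.ofLp : Vec d → _) ⁻¹' (univ.pi s)) = ∏ i, volume (s i) := fun s hs => by
    rw [(PiLp.volume_preserving_ofLp (Fin d)).measure_preimage
      (MeasurableSet.univ_pi hs).nullMeasurableSet, volume_pi_pi]
  refine Measure.pi_eq fun s hs => ?_
  rw [Measure.map_apply (by fun_prop) (MeasurableSet.univ_pi hs), uniformBox,
    cond_apply (isClosed_linfBall d _).measurableSet, hbox, ← preimage_inter, ← pi_inter_distrib,
    hvol _ fun _ => measurableSet_Icc, hvol _ fun i => measurableSet_Icc.inter (hs i)]
  simp only [uniformSeg, cond_apply measurableSet_Icc, Finset.prod_mul_distrib]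
  congr 1
  rw [ENNReal.prod_inv_distrib]
  intro i _ j _ _
  left; simp [hα]

theorem uniformBox_isProbabilityMeasure (d : ℕ) {α : ℝ} (hα : 0 < α) :
    IsProbabilityMeasure (uniformBox d α) := by
  have := uniformSeg_isProbabilityMeasure hα
  refine ⟨?_⟩
  have h := congrArg (fun μ => μ univ) (map_ofLp_uniformBox d hα)
  simpa [Measure.map_apply (show Measurable (WithLp.ofLp : Vec d → _) by fun_prop)
    MeasurableSet.univ] using h

theorem ae_mem_uniformBox (d : ℕ) (α : ℝ) :
    ∀ᵐ u ∂(uniformBox d α), u ∈ linfBall d (ENNReal.ofReal (α / 2)) := by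
  exact ae_cond_mem (isClosed_linfBall d _).measurableSet

theorem uniformBox_absolutelyContinuous (d : ℕ) (α : ℝ) : uniformBox d α ≪ volume :=
  cond_absolutelyContinuous

theorem measurePreserving_setCoord (d : ℕ) {α : ℝ} (hα : 0 < α) (i : Fin d) :
    MeasurePreserving (fun q : Vec d × ℝ => setCoord q.1 i q.2)
      ((uniformBox d α).prod (uniformSeg α)) (uniformBox d α) := by
  have := uniformSeg_isProbabilityMeasure hα
  have := uniformBox_isProbabilityMeasure d hα
  have h0 : MeasurePreserving (WithLp.ofLp : Vec d → _) (uniformBox d α)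
    (Measure.pi fun _ : Fin d => uniformSeg α) := ⟨by fun_prop, map_ofLp_uniformBox d hα⟩
  have h1 : MeasurePreserving (WithLp.toLp 2 : _ → Vec d) (Measure.pi fun _ : Fin d => uniformSeg α)
      (uniformBox d α) := by
    refine ⟨by fun_prop, ?_⟩
    rw [← map_ofLp_uniformBox d hα, Measure.map_map (by fun_prop) (by fun_prop)]
    exact Measure.map_id
  exact h1.comp ((measurePreserving_update_pi (fun _ : Fin d => uniformSeg α) i).comp
    (h0.prod (MeasurePreserving.id _)))

theorem integral_uniformSeg {α : ℝ} (hα : 0 < α) (φ : ℝ → ℝ) :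
    ∫ s, φ s ∂(uniformSeg α) = α⁻¹ * ∫ s in (-(α / 2))..(α / 2), φ s := by
  rw [uniformSeg, ProbabilityTheory.cond, integral_smul_measure, intervalIntegral.integral_of_le (by linarith),
    integral_Icc_eq_integral_Ioc]
  simp [ENNReal.toReal_ofReal, hα.le]

theorem integral_norm_sq_uniformBox (d : ℕ) {α : ℝ} (hα : 0 < α) :
    Integrable (fun u : Vec d => ‖u‖ ^ 2) (uniformBox d α) ∧
    ∫ u, ‖u‖ ^ 2 ∂(uniformBox d α) = d * (α ^ 2 / 12) := by
  have := uniformSeg_isProbabilityMeasure hα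
  have := uniformBox_isProbabilityMeasure d hα
  have h0 : MeasurePreserving (WithLp.ofLp : Vec d → _) (uniformBox d α)
    (Measure.pi fun _ : Fin d => uniformSeg α) := ⟨by fun_prop, map_ofLp_uniformBox d hα⟩
  have hc : ∀ i : Fin d, MeasurePreserving (fun u : Vec d => u i) (uniformBox d α) (uniformSeg α) :=
    fun i => (measurePreserving_eval (fun _ : Fin d => uniformSeg α) i).comp h0
  have hint : ∀ i : Fin d, Integrable (fun u : Vec d => u i ^ 2) (uniformBox d α) := fun i => by
    refine Integrable.of_bound (C := (α / 2) ^ 2) (by fun_prop) ?_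
    filter_upwards [ae_mem_uniformBox d α] with u hu
    rw [linfBall_ofReal d (by positivity)] at hu
    rw [Real.norm_eq_abs, abs_pow]
    exact pow_le_pow_left₀ (abs_nonneg _) (hu i) 2
  simp only [EuclideanSpace.norm_sq_eq, Real.norm_eq_abs, sq_abs]
  refine ⟨integrable_finsetSum _ fun i _ => hint i, ?_⟩
  rw [integral_finsetSum _ fun i _ => hint i]
  have : ∀ i : Fin d, ∫ u : Vec d, u i ^ 2 ∂(uniformBox d α) = α ^ 2 / 12 := fun i => by
    have h := integral_map (μ := uniformBox d α) (hc i).measurable.aemeasurable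
      (f := fun s : ℝ => s ^ 2) (by fun_prop)
    rw [← h, (hc i).map_eq, integral_uniformSeg hα, integral_pow]
    field_simp
    ring
  simp [this]

/-! ### Smoothing of Lipschitz functions -/

open scoped NNReal

theorem norm_le_of_abs_le {d : ℕ} {r : ℝ} (hr : 0 ≤ r) {z : Vec d} (h : ∀ i, |z i| ≤ r) :
    ‖z‖ ≤ √d * r := by
  rw [EuclideanSpace.norm_eq]
  calc √(∑ i, ‖z i‖ ^ 2) ≤ √(∑ _i : Fin d, r ^ 2) := by
        refine Real.sqrt_le_sqrt (Finset.sum_le_sum fun i _ => ?_)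
        exact pow_le_pow_left₀ (norm_nonneg _) (h i) 2
    _ = √d * r := by simp [Real.sqrt_sq hr]

theorem ae_norm_le_uniformBox (d : ℕ) {α : ℝ} (hα : 0 < α) :
    ∀ᵐ u ∂(uniformBox d α), ‖u‖ ≤ √d * (α / 2) := by
  filter_upwards [ae_mem_uniformBox d α] with u hu
  rw [linfBall_ofReal d (by positivity)] at hu
  exact norm_le_of_abs_le (by positivity) hu

section Lipschitz

variable {d : ℕ} {f : Vec d → ℝ} {C : ℝ≥0} {α : ℝ}

theorem integrable_lipschitz_uniformBox (hf : LipschitzWith C f) (hα : 0 < α) (w : Vec d) :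
    Integrable (fun u => f (w + u)) (uniformBox d α) := by
  have := uniformBox_isProbabilityMeasure d hα
  refine Integrable.of_bound (C := ‖f w‖ + C * (√d * (α / 2)))
    (hf.continuous.comp (by fun_prop)).aestronglyMeasurable ?_
  filter_upwards [ae_norm_le_uniformBox d hα] with u hu
  have h1 := hf.norm_sub_le (w + u) w
  rw [add_sub_cancel_left] at h1
  have h2 := norm_le_norm_add_norm_sub (f w) (f (w + u))
  rw [norm_sub_rev] at h2
  have h3 : C * ‖u‖ ≤ C * (√d * (α / 2)) := by gcongr
  linarith

theorem LipschitzWith.ae_uniformBox_differentiableAt (hf : LipschitzWith C f) (w : Vec d) :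
    ∀ᵐ u ∂(uniformBox d α), DifferentiableAt ℝ f (w + u) :=
  (uniformBox_absolutelyContinuous d α).ae_le <|
    (measurePreserving_add_left volume w).quasiMeasurePreserving.ae hf.ae_differentiableAt

/-- By Rademacher's theorem `f` is differentiable at `w + u` for almost every `u`, and the Lipschitz
constant dominates the difference quotients, so differentiation passes under the integral. -/
theorem hasFDerivAt_smooth (hf : LipschitzWith C f) (hα : 0 < α) (w : Vec d) :
    Integrable (fun u => fderiv ℝ f (w + u)) (uniformBox d α) ∧
    HasFDerivAt (smooth f α) (∫ u, fderiv ℝ f (w + u) ∂(uniformBox d α)) w := by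
  have := uniformBox_isProbabilityMeasure d hα
  refine hasFDerivAt_integral_of_dominated_loc_of_lip (F := fun x u => f (x + u))
    (bound := fun _ => (C : ℝ)) (s := univ) univ_mem ?_ (integrable_lipschitz_uniformBox hf hα w)
    ?_ ?_ (integrable_const _) ?_
  · exact Eventually.of_forall fun x => (hf.continuous.comp (by fun_prop)).aestronglyMeasurable
  · exact ((measurable_fderiv ℝ f).comp (measurable_const_add w)).aestronglyMeasurable
  · refine Eventually.of_forall fun u => LipschitzOnWith.of_dist_le_mul fun x _ y _ => ?_
    simpa using hf.dist_le_mul (x + u) (y + u)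
  · filter_upwards [LipschitzWith.ae_uniformBox_differentiableAt hf w] with u hu
    have := HasFDerivAt.comp (f := fun x : Vec d => x + u) w hu.hasFDerivAt
      ((hasFDerivAt_id w).add_const u)
    simpa [Function.comp_def] using this

theorem gradient_smooth (hf : LipschitzWith C f) (hα : 0 < α) (w : Vec d) :
    Integrable (fun u => ∇ f (w + u)) (uniformBox d α) ∧
    ∇ (smooth f α) w = ∫ u, ∇ f (w + u) ∂(uniformBox d α) := by
  obtain ⟨h1, h2⟩ := hasFDerivAt_smooth hf hα w
  let T := (InnerProductSpace.toDual ℝ (Vec d)).symm.toContinuousLinearEquiv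
  refine ⟨T.toContinuousLinearMap.integrable_comp h1, ?_⟩
  rw [gradient, h2.fderiv]
  exact (T.integral_comp_comm _).symm

theorem setCoord_add {w u : Vec d} (i : Fin d) (t s : ℝ) :
    w + t • EuclideanSpace.single i (1 : ℝ) + setCoord u i s = setCoord (w + u) i (w i + t + s) := by
  ext j
  by_cases h : j = i
  · subst h; simp [setCoord]
  · simp [setCoord, h]

theorem measurable_setCoord (i : Fin d) :
    Measurable fun q : Vec d × ℝ => setCoord q.1 i q.2 := by
  unfold setCoord
  refine (WithLp.measurable_toLp 2 _).comp (measurable_pi_lambda _ fun j => ?_)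
  by_cases h : j = i
  · subst h; simpa using measurable_snd
  · simp only [Function.update_of_ne h]; fun_prop

theorem continuous_setCoord (i : Fin d) : Continuous fun q : Vec d × ℝ => setCoord q.1 i q.2 := by
  unfold setCoord
  refine (PiLp.continuous_toLp 2 _).comp (Continuous.update (by fun_prop) i continuous_snd)

/-- Resampling the `i`-th coordinate of `u` as a separate variable `s` confines the shift `t` to the
inner one-dimensional average. -/
theorem smooth_add_smul_single (hf : LipschitzWith C f) (hα : 0 < α) (w : Vec d) (i : Fin d)
    (t : ℝ) :
    smooth f α (w + t • EuclideanSpace.single i (1 : ℝ)) =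
      ∫ u, ∫ s, f (setCoord (w + u) i (w i + t + s)) ∂(uniformSeg α) ∂(uniformBox d α) := by
  have := uniformBox_isProbabilityMeasure d hα
  have := uniformSeg_isProbabilityMeasure hα
  have hp := measurePreserving_setCoord d hα i
  have hi := integrable_lipschitz_uniformBox hf hα (w + t • EuclideanSpace.single i (1 : ℝ))
  simp only [← setCoord_add]
  rw [← integral_prod (f := fun q : Vec d × ℝ =>
    f (w + t • EuclideanSpace.single i (1 : ℝ) + setCoord q.1 i q.2)) (hp.integrable_comp_of_integrable hi)]
  have h := integral_map (μ := (uniformBox d α).prod (uniformSeg α)) hp.measurable.aemeasurable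
    (f := fun v => f (w + t • EuclideanSpace.single i (1 : ℝ) + v))
    (hf.continuous.comp (by fun_prop)).aestronglyMeasurable
  rw [← h, hp.map_eq, smooth]

/-- A sliding average over a window of length `α` has as derivative the difference of the end values
divided by `α`. This makes `finDiff` unbiased and yields the Lipschitz constant of the gradient. -/
theorem gradient_smooth_apply (hf : LipschitzWith C f) (hα : 0 < α) (w : Vec d) (i : Fin d) :
    (∇ (smooth f α) w) i = α⁻¹ * ∫ u, (f (setCoord (w + u) i (w i + α / 2)) -
      f (setCoord (w + u) i (w i - α / 2))) ∂(uniformBox d α) := by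
  have := uniformBox_isProbabilityMeasure d hα
  have := uniformSeg_isProbabilityMeasure hα
  have hcont : Continuous fun q : (Vec d × ℝ) × ℝ =>
      f (setCoord (w + q.1.1) i (w i + q.1.2 + q.2)) :=
    hf.continuous.comp ((continuous_setCoord i).comp
      (f := fun p : (Vec d × ℝ) × ℝ => (w + p.1.1, w i + p.1.2 + p.2)) (by fun_prop))
  have hline : HasDerivAt (fun t : ℝ => smooth f α (w + t • EuclideanSpace.single i (1 : ℝ)))
      ((∇ (smooth f α) w) i) 0 := by
    have h1 := hasGradientAt_iff_hasFDerivAt.1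
      (hasFDerivAt_smooth hf hα w).2.differentiableAt.hasGradientAt
    have h2 : HasDerivAt (fun t : ℝ => w + t • EuclideanSpace.single i (1 : ℝ))
        (EuclideanSpace.single i (1 : ℝ)) 0 := by
      simpa using ((hasDerivAt_id (0 : ℝ)).smul_const (EuclideanSpace.single i (1 : ℝ))).const_add w
    have h3 := HasFDerivAt.comp_hasDerivAt (f := fun t : ℝ => w + t • EuclideanSpace.single i (1 : ℝ))
      (0 : ℝ) (by simpa only [zero_smul, add_zero] using h1) h2
    rw [InnerProductSpace.toDual_apply_apply, EuclideanSpace.inner_single_right] at h3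
    simpa [Function.comp_def] using h3
  have hpar := (hasDerivAt_integral_of_dominated_loc_of_lip (μ := uniformBox d α) (x₀ := (0 : ℝ))
    (F := fun t u => ∫ s, f (setCoord (w + u) i (w i + t + s)) ∂(uniformSeg α))
    (F' := fun u => α⁻¹ * (f (setCoord (w + u) i (w i + α / 2)) -
      f (setCoord (w + u) i (w i - α / 2))))
    (bound := fun _ => (C : ℝ)) (s := univ) univ_mem ?_ ?_ ?_ ?_ (integrable_const _) ?_).2
  · simp only [← smooth_add_smul_single hf hα] at hpar
    rw [← integral_const_mul]
    exact hline.unique hpar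
  · refine Eventually.of_forall fun t => ?_
    exact (StronglyMeasurable.integral_prod_right (f := fun u s => f (setCoord (w + u) i (w i + t + s)))
      (hcont.comp (f := fun q : Vec d × ℝ => ((q.1, t), q.2)) (by fun_prop)).stronglyMeasurable
      ).aestronglyMeasurable
  · have hp := measurePreserving_setCoord d hα i
    have hi := integrable_lipschitz_uniformBox hf hα (w + (0 : ℝ) • EuclideanSpace.single i (1 : ℝ))
    simp only [← setCoord_add]
    exact (hp.integrable_comp_of_integrable hi).integral_prod_left
  · refine Continuous.aestronglyMeasurable ?_
    have h1 := hcont.comp (f := fun u : Vec d => ((u, α / 2), (0 : ℝ))) (by fun_prop)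
    have h2 := hcont.comp (f := fun u : Vec d => ((u, -(α / 2)), (0 : ℝ))) (by fun_prop)
    simp only [Function.comp_def, add_zero, ← sub_eq_add_neg] at h1 h2
    exact continuous_const.mul (h1.sub h2)
  · refine Eventually.of_forall fun u => LipschitzOnWith.of_dist_le_mul fun t _ t' _ => ?_
    have hint : ∀ t, Integrable (fun s => f (setCoord (w + u) i (w i + t + s))) (uniformSeg α) := by
      intro t
      have h := (hcont.comp (f := fun s : ℝ => ((u, t), s)) (by fun_prop)).integrableOn_Icc
        (μ := volume) (a := -(α / 2)) (b := α / 2)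
      exact Integrable.smul_measure h (by simp [hα])
    rw [dist_eq_norm, ← integral_sub (hint t) (hint t')]
    have := norm_integral_le_of_norm_le_const (μ := uniformSeg α)
      (f := fun s => f (setCoord (w + u) i (w i + t + s)) - f (setCoord (w + u) i (w i + t' + s)))
      (C := C * dist t t') (Eventually.of_forall fun s => ?_)
    · simpa using this
    · simp only [← setCoord_add]
      refine (hf.norm_sub_le _ _).trans_eq ?_
      rw [add_sub_add_right_eq_sub, add_sub_add_left_eq_sub, ← sub_smul, norm_smul]
      simp [Real.dist_eq]
  · refine Eventually.of_forall fun u => ?_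
    have hc : Continuous fun s => f (setCoord (w + u) i s) := by
      have := hcont.comp (f := fun s : ℝ => ((u, - w i), s)) (by fun_prop)
      simpa [Function.comp_def] using this
    -- The inner average is `α⁻¹` times the difference of a primitive at `w i + t ± α / 2`.
    have hG := fun x => (hc.integral_hasStrictDerivAt 0 x).hasDerivAt
    have h1 : HasDerivAt (fun t : ℝ => w i + t + α / 2) 1 0 :=
      ((hasDerivAt_id (0 : ℝ)).const_add _).add_const _
    have h2 : HasDerivAt (fun t : ℝ => w i + t - α / 2) 1 0 :=
      ((hasDerivAt_id (0 : ℝ)).const_add _).sub_const _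
    have h3 := HasDerivAt.comp (0 : ℝ) (hG _) h1
    have h4 := HasDerivAt.comp (0 : ℝ) (hG _) h2
    have h5 := (h3.sub h4).const_mul α⁻¹
    simp only [add_zero, mul_one] at h5
    refine h5.congr_of_eventuallyEq (Eventually.of_forall fun t => ?_)
    simp only [Function.comp_def, Pi.sub_apply]
    rw [integral_uniformSeg hα, intervalIntegral.integral_interval_sub_left
      (hc.intervalIntegrable _ _) (hc.intervalIntegrable _ _),
      intervalIntegral.integral_comp_add_left (fun s => f (setCoord (w + u) i s))]
    ring_nf

/-- Each component is `α⁻¹` times the mean of a difference of two values of `f`, each of which moves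
by at most `C * ‖x - y‖`; passing from components to the Euclidean norm costs `√d`. -/
theorem norm_gradient_smooth_sub_le (hf : LipschitzWith C f) (hα : 0 < α) (x y : Vec d) :
    ‖∇ (smooth f α) x - ∇ (smooth f α) y‖ ≤ 2 * √d * C / α * ‖x - y‖ := by
  have := uniformBox_isProbabilityMeasure d hα
  have hint : ∀ (w : Vec d) (i : Fin d) (a : ℝ),
      Integrable (fun u => f (setCoord (w + u) i a)) (uniformBox d α) := by
    intro w i a
    refine Integrable.of_bound (C := ‖f w‖ + C * (√d * (α / 2 + |a - w i|)))
      (hf.continuous.comp ((continuous_setCoord i).comp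
        (f := fun u : Vec d => (w + u, a)) (by fun_prop))).aestronglyMeasurable ?_
    filter_upwards [ae_mem_uniformBox d α] with u hu
    rw [linfBall_ofReal d (by positivity)] at hu
    have h1 := hf.norm_sub_le (setCoord (w + u) i a) w
    have h2 := norm_le_norm_add_norm_sub (f w) (f (setCoord (w + u) i a))
    rw [norm_sub_rev] at h2
    have h3 : C * ‖setCoord (w + u) i a - w‖ ≤ C * (√d * (α / 2 + |a - w i|)) := by
      gcongr
      refine norm_le_of_abs_le (by positivity) fun j => ?_
      by_cases h : j = i
      · subst h
        have : 0 < α / 2 := by positivity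
        simp [setCoord, this.le]
      · have := hu j
        have h4 := abs_nonneg (a - w i)
        simp only [setCoord, PiLp.sub_apply, Function.update_of_ne h, PiLp.add_apply,
          add_sub_cancel_left]
        linarith
    linarith
  have hb : ∀ (i : Fin d) (u : Vec d) (a : ℝ),
      |f (setCoord (x + u) i (x i + a)) - f (setCoord (y + u) i (y i + a))| ≤ C * ‖x - y‖ := by
    intro i u a
    have h := setCoord_add (w := x) (u := u) i 0 a
    have h' := setCoord_add (w := y) (u := u) i 0 a
    simp only [zero_smul, add_zero] at h h'
    rw [← h, ← h']
    simpa using hf.norm_sub_le (x + setCoord u i a) (y + setCoord u i a)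
  have key : ∀ i, |(∇ (smooth f α) x - ∇ (smooth f α) y) i| ≤ 2 * C / α * ‖x - y‖ := by
    intro i
    rw [PiLp.sub_apply, gradient_smooth_apply hf hα, gradient_smooth_apply hf hα, ← mul_sub,
      ← integral_sub (f := fun u => f (setCoord (x + u) i (x i + α / 2)) -
        f (setCoord (x + u) i (x i - α / 2))) (g := fun u => f (setCoord (y + u) i (y i + α / 2)) -
        f (setCoord (y + u) i (y i - α / 2))) ((hint _ _ _).sub (hint _ _ _))
        ((hint _ _ _).sub (hint _ _ _)), abs_mul, abs_of_pos (inv_pos.2 hα)]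
    have := norm_integral_le_of_norm_le_const (μ := uniformBox d α)
      (f := fun u => f (setCoord (x + u) i (x i + α / 2)) - f (setCoord (x + u) i (x i - α / 2)) -
        (f (setCoord (y + u) i (y i + α / 2)) - f (setCoord (y + u) i (y i - α / 2))))
      (C := 2 * C * ‖x - y‖) (Eventually.of_forall fun u => ?_)
    · simp only [probReal_univ, mul_one, Real.norm_eq_abs] at this
      calc _ ≤ α⁻¹ * (2 * C * ‖x - y‖) := by gcongr
        _ = _ := by ring
    · have h1 := hb i u (α / 2)
      have h2 := hb i u (-(α / 2))
      simp only [← sub_eq_add_neg] at h2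
      rw [Real.norm_eq_abs, sub_sub_sub_comm]
      refine (abs_sub_le _ 0 _).trans ?_
      rw [sub_zero, zero_sub, abs_neg]
      linarith
  refine (norm_le_of_abs_le (by positivity) key).trans_eq (by ring)

theorem abs_smooth_sub_le (hf : LipschitzWith C f) (hα : 0 < α) (hd : 0 < d) (w : Vec d) :
    |smooth f α w - f w| ≤ C * (α * √(d / 12)) := by
  have := uniformBox_isProbabilityMeasure d hα
  obtain ⟨h1, h2⟩ := integral_norm_sq_uniformBox d hα
  -- `c` is the root mean square of `‖u‖`. The bound `‖u‖ ≤ (‖u‖² / c + c) / 2` replaces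
  -- Cauchy–Schwarz and is sharp after integration.
  set c := α * √(d / 12) with hc
  have hd' : (0 : ℝ) < d := by exact_mod_cast hd
  have hc0 : 0 < c := by positivity
  have hc2 : c ^ 2 = d * (α ^ 2 / 12) := by
    rw [hc, mul_pow, Real.sq_sqrt (by positivity)]; ring
  have h3 : smooth f α w - f w = ∫ u, (f (w + u) - f w) ∂(uniformBox d α) := by
    rw [integral_sub (integrable_lipschitz_uniformBox hf hα w) (integrable_const _)]
    simp [smooth]
  rw [h3]
  have hi : Integrable (fun u : Vec d => C * ((‖u‖ ^ 2 / c + c) / 2)) (uniformBox d α) :=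
    (((h1.div_const c).add (integrable_const c)).div_const 2).const_mul (C : ℝ)
  calc _ ≤ ∫ u : Vec d, C * ((‖u‖ ^ 2 / c + c) / 2) ∂(uniformBox d α) := by
        rw [← Real.norm_eq_abs]
        refine norm_integral_le_of_norm_le hi (Eventually.of_forall fun u => ?_)
        refine (hf.norm_sub_le (w + u) w).trans ?_
        rw [add_sub_cancel_left]
        gcongr
        rw [le_div_iff₀ two_pos, div_add' _ _ _ hc0.ne', le_div_iff₀ hc0]
        nlinarith [sq_nonneg (‖u‖ - c)]
    _ = C * c := by
        rw [integral_const_mul, integral_div, integral_add (h1.div_const c) (integrable_const c),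
          integral_div, h2, ← hc2, integral_const (μ := uniformBox d α) c, probReal_univ, one_smul]
        field_simp
        norm_num

end Lipschitz

/-! ### Normal cones -/

/-- Squaring the minimality of `y` gives `⟨x - y, z - y⟩ ≤ ‖z - y‖² / 2`, so the quotient in the
cone's definition is bounded above by a multiple of `‖z - y‖`. Convexity of `T` plays no role. -/
theorem smul_sub_mem_frechetNormalCone {d : ℕ} {T : Set (Vec d)} {x y : Vec d}
    (h : y ∈ projSet T x) {c : ℝ} (hc : 0 ≤ c) : c • (x - y) ∈ frechetNormalCone T y := by
  refine ⟨h.1, le_of_forall_gt_imp_ge_of_dense fun a ha => ?_⟩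
  have ht : Tendsto (fun z : Vec d => ((c * (‖z - y‖ / 2) : ℝ) : EReal)) (𝓝 y) (𝓝 0) := by
    rw [← EReal.coe_zero, EReal.tendsto_coe]
    have : Continuous fun z : Vec d => c * (‖z - y‖ / 2) := by fun_prop
    simpa using this.tendsto y
  refine limsup_le_of_le (by isBoundedDefault) ?_
  filter_upwards [self_mem_nhdsWithin, (ht.mono_left nhdsWithin_le_nhds).eventually_lt_const ha]
    with z hz hza
  refine le_trans (EReal.coe_le_coe_iff.2 ?_) hza.le
  have hpos : 0 < ‖z - y‖ := norm_pos_iff.2 (sub_ne_zero.2 hz.2)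
  rw [div_le_iff₀ hpos, real_inner_smul_left]
  have h1 := h.2 z hz.1
  have h2 : ‖y - x‖ ^ 2 ≤ ‖z - x‖ ^ 2 := pow_le_pow_left₀ (norm_nonneg _) h1 2
  have h3 : z - x = (z - y) - (x - y) := by abel
  rw [h3, norm_sub_sq_real (z - y), norm_sub_rev y x, real_inner_comm] at h2
  calc c * inner ℝ (x - y) (z - y) ≤ c * (‖z - y‖ ^ 2 / 2) := by gcongr; linarith
    _ = _ := by ring

theorem frechetNormalCone_subset_normalCone {d : ℕ} (T : Set (Vec d)) (w : Vec d) :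
    frechetNormalCone T w ⊆ normalCone T w := fun v hv =>
  ⟨hv.1, fun _ => w, fun _ => v, fun _ => ⟨hv.1, hv⟩, tendsto_const_nhds, tendsto_const_nhds⟩

/-- A diagonal argument: each `n k` is approximated by a Fréchet normal at a nearby point, within `1
/ (k + 1)`. -/
theorem mem_normalCone_of_tendsto {d : ℕ} {T : Set (Vec d)} (hT : IsClosed T) {x n : ℕ → Vec d}
    {w v : Vec d} (hx : Tendsto x atTop (𝓝 w)) (hn : Tendsto n atTop (𝓝 v))
    (h : ∀ k, n k ∈ normalCone T (x k)) : v ∈ normalCone T w := by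
  have hwT : w ∈ T := hT.mem_of_tendsto hx (Eventually.of_forall fun k => (h k).1)
  have hk : ∀ k : ℕ, ∃ y u : Vec d, u ∈ frechetNormalCone T y ∧ dist y (x k) < 1 / (k + 1 : ℝ) ∧
      dist u (n k) < 1 / (k + 1 : ℝ) := by
    intro k
    obtain ⟨_, y, u, hyu, hy, hu⟩ := h k
    have hpos : (0 : ℝ) < 1 / (k + 1) := by positivity
    obtain ⟨j, hj⟩ := ((Metric.tendsto_nhds.1 hy _ hpos).and (Metric.tendsto_nhds.1 hu _ hpos)).exists
    exact ⟨y j, u j, (hyu j).2, hj⟩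
  choose y u hu hy hun using hk
  refine ⟨hwT, y, u, fun k => ⟨(hu k).1, hu k⟩, ?_, ?_⟩
  · refine tendsto_iff_of_dist (squeeze_zero (fun _ => dist_nonneg) (fun k => (hy k).le)
      tendsto_one_div_add_atTop_nhds_zero_nat) |>.2 hx
  · refine tendsto_iff_of_dist (squeeze_zero (fun _ => dist_nonneg) (fun k => (hun k).le)
      tendsto_one_div_add_atTop_nhds_zero_nat) |>.2 hn

/-- The distance from `0` to the sum of an upper semicontinuous compact-valued multifunction and of
a multifunction with closed graph over a closed set is Borel measurable. -/
theorem measurable_infEDist_add {d : ℕ} {A N : Vec d → Set (Vec d)} {T : Set (Vec d)}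
    (hN0 : ∀ w ∉ T, N w = ∅)
    (hN : ∀ (x n : ℕ → Vec d) (w v : Vec d), Tendsto x atTop (𝓝 w) → Tendsto n atTop (𝓝 v) →
      (∀ k, n k ∈ N (x k)) → v ∈ N w)
    (hA : ∀ (x a : ℕ → Vec d) (w : Vec d), Tendsto x atTop (𝓝 w) → (∀ k, x k ∈ T) →
      (∀ k, a k ∈ A (x k)) → ∃ a₀ ∈ A w, ∃ φ : ℕ → ℕ, StrictMono φ ∧
        Tendsto (a ∘ φ) atTop (𝓝 a₀)) :
    Measurable fun w => Metric.infEDist 0 (A w + N w) := by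
  refine measurable_of_Iic fun c => ?_
  by_cases hc : c = ⊤
  · simp [hc]
  -- The distance is lower semicontinuous. Near-minimising sums `a + n` are bounded, and `a`
  -- subconverges by `hA`, so `n` subconverges too and the closed graph of `N` applies.
  refine IsClosed.measurableSet (IsSeqClosed.isClosed ?_)
  intro x w hxc hx
  have hk : ∀ k : ℕ, ∃ a n : Vec d, a ∈ A (x k) ∧ n ∈ N (x k) ∧
      edist 0 (a + n) < c + (k + 1 : ℝ≥0∞)⁻¹ := by
    intro k
    have : Metric.infEDist 0 (A (x k) + N (x k)) < c + (k + 1 : ℝ≥0∞)⁻¹ :=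
      lt_of_le_of_lt (hxc k) (ENNReal.lt_add_right hc (by simp))
    obtain ⟨y, hy, hy'⟩ := Metric.infEDist_lt_iff.1 this
    obtain ⟨a, ha, n, hn, rfl⟩ := hy
    exact ⟨a, n, ha, hn, hy'⟩
  choose a n ha hn han using hk
  -- A finite distance forces the sum to be nonempty, which is impossible off `T`.
  have hxT : ∀ k, x k ∈ T := fun k => by
    by_contra h
    have := hn k
    rw [hN0 _ h] at this
    exact this
  obtain ⟨a₀, ha₀, φ, hφ, hlim⟩ := hA x a w hx hxT ha
  have hbd : ∀ k, (a + n) (φ k) ∈ Metric.closedBall (0 : Vec d) (c + 1).toReal := fun k => by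
    rw [Metric.mem_closedBall, dist_comm, dist_edist]
    refine ENNReal.toReal_mono (by simp [hc]) ((han (φ k)).le.trans ?_)
    gcongr
    simp
  obtain ⟨y₀, -, ψ, hψ, hy₀⟩ := (isCompact_closedBall (0 : Vec d) (c + 1).toReal).tendsto_subseq hbd
  have hn₀ : Tendsto (n ∘ φ ∘ ψ) atTop (𝓝 (y₀ - a₀)) := by
    refine (hy₀.sub (hlim.comp hψ.tendsto_atTop)).congr fun k => ?_
    simp
  have hφψ := hφ.tendsto_atTop.comp hψ.tendsto_atTop
  have hmem := hN _ _ _ _ (hx.comp hφψ) hn₀ fun k => hn _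
  have hle : edist 0 y₀ ≤ c := by
    have h1 : Tendsto (fun k => edist 0 ((a + n) (φ (ψ k)))) atTop (𝓝 (edist 0 y₀)) :=
      (continuous_const.edist continuous_id).tendsto y₀ |>.comp hy₀
    have h2 : Tendsto (fun k : ℕ => c + (k + 1 : ℝ≥0∞)⁻¹) atTop (𝓝 c) := by
      have := (ENNReal.tendsto_inv_nat_nhds_zero.comp (tendsto_add_atTop_nat 1)).const_add c
      simpa [Function.comp_def] using this
    exact le_of_tendsto_of_tendsto h1 (h2.comp hφψ) (Eventually.of_forall fun k => (han _).le)
  refine le_trans (Metric.infEDist_le_edist_of_mem ?_) hle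
  exact ⟨a₀, ha₀, y₀ - a₀, hmem, by simp⟩

theorem measurable_infEDist_add_normalCone {d : ℕ} {A : Vec d → Set (Vec d)} {T : Set (Vec d)}
    (hT : IsClosed T)
    (hA : ∀ (x a : ℕ → Vec d) (w : Vec d), Tendsto x atTop (𝓝 w) → (∀ k, x k ∈ T) →
      (∀ k, a k ∈ A (x k)) → ∃ a₀ ∈ A w, ∃ φ : ℕ → ℕ, StrictMono φ ∧
        Tendsto (a ∘ φ) atTop (𝓝 a₀)) :
    Measurable fun w => Metric.infEDist 0 (A w + normalCone T w) :=
  measurable_infEDist_add (T := T) (fun _ hw => eq_empty_of_forall_notMem fun _ hv => hw hv.1)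
    (fun _ _ _ _ hx hn h => mem_normalCone_of_tendsto hT hx hn h) hA

/-! ### One projected gradient step on a smooth function -/

/-- Along the segment from `x` to `y`, `φ` minus its quadratic upper model has nonpositive
derivative. -/
theorem descent_le {E : Type*} [NormedAddCommGroup E] [InnerProductSpace ℝ E] [CompleteSpace E]
    {φ : E → ℝ} {G : E → E} {L : ℝ} (hφ : ∀ x, HasGradientAt φ (G x) x)
    (hG : ∀ x y, ‖G x - G y‖ ≤ L * ‖x - y‖) (x y : E) :
    φ y ≤ φ x + inner ℝ (G x) (y - x) + L / 2 * ‖y - x‖ ^ 2 := by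
  set v := y - x with hv
  have hline : ∀ t : ℝ, HasDerivAt (fun t : ℝ => φ (x + t • v) - t * inner ℝ (G x) v -
      L / 2 * t ^ 2 * ‖v‖ ^ 2)
      (inner ℝ (G (x + t • v)) v - inner ℝ (G x) v - L * t * ‖v‖ ^ 2) t := by
    intro t
    have h1 : HasDerivAt (fun t : ℝ => x + t • v) v t := by
      simpa using ((hasDerivAt_id t).smul_const v).const_add x
    have h2 := (hasGradientAt_iff_hasFDerivAt.1 (hφ (x + t • v))).comp_hasDerivAt t h1
    have h3 := (h2.sub ((hasDerivAt_id t).mul_const (inner ℝ (G x) v))).sub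
      ((((hasDerivAt_id t).pow 2).const_mul (L / 2)).mul_const (‖v‖ ^ 2))
    refine h3.congr_deriv ?_
    simp only [InnerProductSpace.toDual_apply_apply, id]
    ring
  have hanti : AntitoneOn (fun t : ℝ => φ (x + t • v) - t * inner ℝ (G x) v -
      L / 2 * t ^ 2 * ‖v‖ ^ 2) (Icc 0 1) := by
    refine antitoneOn_of_deriv_nonpos (convex_Icc 0 1)
      (fun t _ => (hline t).continuousAt.continuousWithinAt)
      (fun t _ => (hline t).differentiableAt.differentiableWithinAt) fun t ht => ?_
    rw [interior_Icc] at ht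
    rw [(hline t).deriv, ← inner_sub_left]
    have h1 := real_inner_le_norm (G (x + t • v) - G x) v
    have h2 := hG (x + t • v) x
    rw [add_sub_cancel_left, norm_smul, Real.norm_of_nonneg ht.1.le] at h2
    nlinarith [mul_le_mul_of_nonneg_right h2 (norm_nonneg v)]
  have := hanti (left_mem_Icc.2 zero_le_one) (right_mem_Icc.2 zero_le_one) zero_le_one
  simp only [one_smul, zero_smul, add_zero] at this
  rw [hv, add_sub_cancel, ← hv] at this
  nlinarith

theorem le_descent {E : Type*} [NormedAddCommGroup E] [InnerProductSpace ℝ E] [CompleteSpace E]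
    {φ : E → ℝ} {G : E → E} {L : ℝ} (hφ : ∀ x, HasGradientAt φ (G x) x)
    (hG : ∀ x y, ‖G x - G y‖ ≤ L * ‖x - y‖) (x y : E) :
    φ x + inner ℝ (G x) (y - x) - L / 2 * ‖y - x‖ ^ 2 ≤ φ y := by
  have := descent_le (φ := fun x => -φ x) (G := fun x => -G x) (L := L) (fun x => ?_) ?_ x y
  · rw [inner_neg_left] at this
    linarith
  · have := hasGradientAt_iff_hasFDerivAt.1 (hφ x)
    rw [hasGradientAt_iff_hasFDerivAt, map_neg]
    exact this.neg
  · intro x y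
    rw [← neg_sub', norm_neg]
    exact hG x y

/-- The squared stationarity residual of one projected step with the perturbed gradient `g`. -/
theorem sq_infEDist_le_of_step {d : ℕ} {T : Set (Vec d)} {φ : Vec d → ℝ} {G : Vec d → Vec d}
    {L ρ : ℝ} (hL : 0 < L) (hρ : 1 < ρ) (hφ : ∀ x, HasGradientAt φ (G x) x)
    (hG : ∀ x y, ‖G x - G y‖ ≤ L * ‖x - y‖) {w g w' : Vec d} (hw : w ∈ T)
    (hw' : w' ∈ projSet T (w - (2 / (3 * ρ * L)) • g)) :
    0 ≤ (2 * (1 + ρ) / (ρ - 1) + 3 * ρ) * L * (φ w - φ w') +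
        (2 * (1 + ρ) / (ρ - 1) + 3) * ‖g - G w‖ ^ 2 ∧
    Metric.infEDist 0 ({G w'} + normalCone T w') ^ 2 ≤ ENNReal.ofReal
      ((2 * (1 + ρ) / (ρ - 1) + 3 * ρ) * L * (φ w - φ w') +
        (2 * (1 + ρ) / (ρ - 1) + 3) * ‖g - G w‖ ^ 2) := by
  set η := 2 / (3 * ρ * L) with hη
  have hη0 : 0 < η := by positivity
  set δ := w' - w with hδ
  set e := g - G w with he
  -- The displacement made by the projection, divided by `η`, is normal at `w'`. Adding it to `G w'`
  -- gives a point of the sum whose norm bounds the distance.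
  have hn := frechetNormalCone_subset_normalCone T w'
    (smul_sub_mem_frechetNormalCone hw' (inv_nonneg.2 hη0.le))
  have hr : G w' - g - η⁻¹ • δ = G w' + η⁻¹ • (w - η • g - w') := by
    have h1 : w - η • g - w' = -(δ + η • g) := by rw [hδ]; abel
    rw [h1, smul_neg, smul_add, smul_smul, inv_mul_cancel₀ hη0.ne', one_smul]
    abel
  have hdist : Metric.infEDist 0 ({G w'} + normalCone T w') ≤
      ENNReal.ofReal ‖G w' - g - η⁻¹ • δ‖ := by
    have hmem : G w' + η⁻¹ • (w - η • g - w') ∈ ({G w'} + normalCone T w' : Set (Vec d)) :=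
      Set.add_mem_add (Set.mem_singleton _) hn
    rw [← hr] at hmem
    refine (Metric.infEDist_le_edist_of_mem hmem).trans_eq ?_
    rw [edist_dist, dist_zero_left]
  -- The previous iterate `w` is itself a competitor in the projection problem.
  have hproj : inner ℝ g δ ≤ - (‖δ‖ ^ 2 / (2 * η)) := by
    have h1 := pow_le_pow_left₀ (norm_nonneg _) (hw'.2 w hw) 2
    have h2 : w' - (w - η • g) = δ + η • g := by rw [hδ]; abel
    have h3 : w - (w - η • g) = η • g := by abel
    rw [h2, h3, norm_add_sq_real, real_inner_smul_right, real_inner_comm] at h1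
    rw [← neg_div, le_div_iff₀ (by positivity)]
    linarith
  have hd1 := descent_le hφ hG w w'
  have hd2 := le_descent hφ hG w' w
  have hwδ : w - w' = -δ := (neg_sub w' w).symm
  rw [hwδ, inner_neg_right, norm_neg] at hd2
  rw [← hδ] at hd1
  have hge : inner ℝ (G w) δ = inner ℝ g δ - inner ℝ e δ := by rw [he, inner_sub_left]; ring
  have hLδ := hG w' w
  rw [← hδ] at hLδ
  have hηinv : η⁻¹ = 3 * ρ * L / 2 := by rw [hη, inv_div]
  have hproj' : inner ℝ g δ ≤ -(3 * ρ * L / 4 * ‖δ‖ ^ 2) := by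
    refine hproj.trans_eq ?_
    rw [hη]; field_simp; ring
  -- The weight in Young's inequality leaves `L / 4`, which together with the `L / 2` of the descent
  -- lemma makes `3 * L / 4`, against `3 * ρ * L / 4` from the projection. This is why `ρ > 1`
  -- suffices.
  have he1 : -inner ℝ e δ ≤ ‖e‖ ^ 2 / L + L / 4 * ‖δ‖ ^ 2 := by
    have h1 := neg_le_of_abs_le (abs_real_inner_le_norm e δ)
    have h2 : ‖e‖ * ‖δ‖ ≤ ‖e‖ ^ 2 / L + L / 4 * ‖δ‖ ^ 2 := by
      rw [div_add' _ _ _ hL.ne', le_div_iff₀ hL]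
      nlinarith [sq_nonneg (‖e‖ - L / 2 * ‖δ‖)]
    linarith
  have hstep : 3 * L / 4 * (ρ - 1) * ‖δ‖ ^ 2 ≤ φ w - φ w' + ‖e‖ ^ 2 / L := by
    rw [hge] at hd1
    linarith
  have hsq : ‖G w' - g‖ ^ 2 ≤ 3 / 2 * L ^ 2 * ‖δ‖ ^ 2 + 3 * ‖e‖ ^ 2 := by
    have h1 : G w' - g = (G w' - G w) - e := by rw [he]; abel
    have h2 : ‖G w' - g‖ ≤ L * ‖δ‖ + ‖e‖ := by
      rw [h1]
      exact (norm_sub_le _ _).trans (by gcongr)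
    have h3 := pow_le_pow_left₀ (norm_nonneg _) h2 2
    nlinarith [sq_nonneg (L * ‖δ‖ - 2 * ‖e‖)]
  -- When the square is expanded, `η⁻² ‖δ‖²` cancels exactly against the bound on `⟨g, δ⟩`. The
  -- remaining `-⟨G w', δ⟩` is bounded by the decrease of `φ` through the lower descent inequality.
  have hX : ‖G w' - g - η⁻¹ • δ‖ ^ 2 ≤
      3 / 2 * (1 + ρ) * L ^ 2 * ‖δ‖ ^ 2 + 3 * ‖e‖ ^ 2 + 3 * ρ * L * (φ w - φ w') := by
    rw [norm_sub_sq_real, real_inner_smul_right, inner_sub_left, norm_smul, hηinv,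
      Real.norm_of_nonneg (by positivity)]
    have h1 : 3 * ρ * L * (inner ℝ g δ - inner ℝ (G w') δ) ≤
        3 * ρ * L * (-(3 * ρ * L / 4 * ‖δ‖ ^ 2) + (φ w - φ w' + L / 2 * ‖δ‖ ^ 2)) := by
      gcongr
      linarith
    linarith
  -- The leftover `‖δ‖²` is traded for decrease and error by scaling `hstep` with `2 * (1 + ρ) / (ρ
  -- - 1) * L`.
  have hfin : 3 / 2 * (1 + ρ) * L ^ 2 * ‖δ‖ ^ 2 ≤
      2 * (1 + ρ) / (ρ - 1) * (L * (φ w - φ w') + ‖e‖ ^ 2) := by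
    have hρ' : 0 < ρ - 1 := by linarith
    have h1 : 2 * (1 + ρ) / (ρ - 1) * L * (3 * L / 4 * (ρ - 1) * ‖δ‖ ^ 2) ≤
        2 * (1 + ρ) / (ρ - 1) * L * (φ w - φ w' + ‖e‖ ^ 2 / L) := by gcongr
    calc _ = 2 * (1 + ρ) / (ρ - 1) * L * (3 * L / 4 * (ρ - 1) * ‖δ‖ ^ 2) := by
          field_simp; ring
      _ ≤ _ := h1
      _ = _ := by field_simp
  have hres : ‖G w' - g - η⁻¹ • δ‖ ^ 2 ≤ (2 * (1 + ρ) / (ρ - 1) + 3 * ρ) * L * (φ w - φ w') +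
      (2 * (1 + ρ) / (ρ - 1) + 3) * ‖e‖ ^ 2 := by linarith
  refine ⟨(sq_nonneg _).trans hres, ?_⟩
  calc _ ≤ ENNReal.ofReal ‖G w' - g - η⁻¹ • δ‖ ^ 2 := by gcongr
    _ = ENNReal.ofReal (‖G w' - g - η⁻¹ • δ‖ ^ 2) := (ENNReal.ofReal_pow (norm_nonneg _) 2).symm
    _ ≤ _ := ENNReal.ofReal_le_ofReal hres

/-! ### Clarke subdifferentials -/

theorem tendsto_add_smul_nhds_prod {d : ℕ} (x v : Vec d) :
    Tendsto (fun q : Vec d × ℝ => q.1 + q.2 • v) (𝓝 x ×ˢ 𝓝[>] (0 : ℝ)) (𝓝 x) := by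
  have h : Continuous fun q : Vec d × ℝ => q.1 + q.2 • v := by fun_prop
  have := h.tendsto (x, 0)
  rw [nhds_prod_eq] at this
  simpa using this.mono_left (prod_mono le_rfl nhdsWithin_le_nhds)

theorem clarkeSubdiff_congr {d : ℕ} {f g : Vec d → ℝ} {x : Vec d} (h : f =ᶠ[𝓝 x] g) :
    clarkeSubdiff f x = clarkeSubdiff g x := by
  have : ∀ v, clarkeDeriv f x v = clarkeDeriv g x v := fun v => by
    refine limsup_congr ?_
    filter_upwards [(tendsto_add_smul_nhds_prod x v).eventually h, tendsto_fst.eventually h]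
      with q h1 h2
    rw [h1, h2]
  simp only [clarkeSubdiff, this]

/-- Freezing the base point at `x` restricts the limsup to difference quotients that converge to the
directional derivative. -/
theorem gradient_mem_clarkeSubdiff {d : ℕ} {f : Vec d → ℝ} {x : Vec d}
    (h : DifferentiableAt ℝ f x) : ∇ f x ∈ clarkeSubdiff f x := by
  intro v
  have h1 : HasDerivAt (fun t : ℝ => x + t • v) v 0 := by
    simpa using ((hasDerivAt_id (0 : ℝ)).smul_const v).const_add x
  have h2 := HasFDerivAt.comp_hasDerivAt (f := fun t : ℝ => x + t • v) (0 : ℝ)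
    (by simpa only [zero_smul, add_zero] using hasGradientAt_iff_hasFDerivAt.1 h.hasGradientAt) h1
  rw [InnerProductSpace.toDual_apply_apply, hasDerivAt_iff_tendsto_slope_zero] at h2
  have h3 : Tendsto (fun t : ℝ => (((f (x + t • v) - f x) / t : ℝ) : EReal)) (𝓝[>] 0)
      (𝓝 ((inner ℝ (∇ f x) v : ℝ) : EReal)) := by
    rw [EReal.tendsto_coe]
    refine (h2.mono_left (nhdsWithin_mono _ fun t ht => ne_of_gt ht)).congr fun t => ?_
    simp [div_eq_inv_mul]
  rw [← h3.limsup_eq]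
  have h4 : Tendsto (fun t : ℝ => (x, t)) (𝓝[>] 0) (𝓝 x ×ˢ 𝓝[>] (0 : ℝ)) :=
    tendsto_const_nhds.prodMk tendsto_id
  exact limsup_le_limsup_of_le (f := map (fun t : ℝ => (x, t)) (𝓝[>] 0))
    (u := fun q : Vec d × ℝ => (((f (q.1 + q.2 • v) - f q.1) / q.2 : ℝ) : EReal)) h4

theorem clarkeDeriv_le {d : ℕ} {f : Vec d → ℝ} {C : ℝ≥0} (hf : LipschitzWith C f) (x v : Vec d) :
    clarkeDeriv f x v ≤ ((C * ‖v‖ : ℝ) : EReal) := by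
  refine limsup_le_of_le (by isBoundedDefault) ?_
  filter_upwards [tendsto_snd.eventually (self_mem_nhdsWithin (a := (0 : ℝ)) (s := Ioi 0))]
    with q hq
  rw [EReal.coe_le_coe_iff, div_le_iff₀ hq]
  have h1 := (le_abs_self _).trans (hf.norm_sub_le (q.1 + q.2 • v) q.1)
  rw [add_sub_cancel_left, norm_smul, Real.norm_of_nonneg (le_of_lt hq)] at h1
  linarith

/-- The defining inequality is tested in the direction `g` itself. -/
theorem norm_le_of_mem_clarkeSubdiff {d : ℕ} {f : Vec d → ℝ} {C : ℝ≥0} (hf : LipschitzWith C f)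
    {x g : Vec d} (hg : g ∈ clarkeSubdiff f x) : ‖g‖ ≤ C := by
  have h := (hg g).trans (clarkeDeriv_le hf x g)
  rw [EReal.coe_le_coe_iff, real_inner_self_eq_norm_sq] at h
  rcases (norm_nonneg g).eq_or_lt with h0 | h0
  · rw [← h0]; exact C.2
  · exact le_of_mul_le_mul_right (by rwa [← sq]) h0

/-- The base point varies inside the limsup, so an upper bound on quotients near `x₀` also holds
near every point close to `x₀`: the Clarke derivative is upper semicontinuous in the base point. -/
theorem mem_clarkeSubdiff_of_tendsto {d : ℕ} {f : Vec d → ℝ} {x g : ℕ → Vec d} {x₀ g₀ : Vec d}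
    (hx : Tendsto x atTop (𝓝 x₀)) (hg : Tendsto g atTop (𝓝 g₀))
    (h : ∀ k, g k ∈ clarkeSubdiff f (x k)) : g₀ ∈ clarkeSubdiff f x₀ := by
  intro v
  refine le_of_forall_gt_imp_ge_of_dense fun a ha => ?_
  obtain ⟨p, hp, r, hr, hpr⟩ := eventually_prod_iff.1 (eventually_lt_of_limsup_lt ha)
  have hinner : Tendsto (fun k => ((inner ℝ (g k) v : ℝ) : EReal)) atTop
      (𝓝 ((inner ℝ g₀ v : ℝ) : EReal)) := by
    rw [EReal.tendsto_coe]
    exact hg.inner tendsto_const_nhds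
  refine le_of_tendsto hinner ?_
  filter_upwards [hx.eventually (eventually_eventually_nhds.2 hp)] with k hk
  refine (h k v).trans (limsup_le_of_le (by isBoundedDefault) ?_)
  exact eventually_prod_iff.2 ⟨p, hk, r, hr, fun hx _ hy => (hpr hx hy).le⟩

/-- Carathéodory's theorem with exactly `finrank + 1` points. -/
theorem exists_stdSimplex_of_mem_convexHull {d : ℕ} {s : Set (Vec d)} {x : Vec d}
    (hx : x ∈ convexHull ℝ s) :
    ∃ (l : Fin (d + 1) → ℝ) (z : Fin (d + 1) → Vec d), l ∈ stdSimplex ℝ (Fin (d + 1)) ∧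
      (∀ i, z i ∈ s) ∧ ∑ i, l i • z i = x := by
  obtain ⟨z₀, hz₀⟩ := convexHull_nonempty_iff.1 ⟨x, hx⟩
  obtain ⟨ι, _, z, w, hz, hind, hw, hw1, hwz⟩ := eq_pos_convex_span_of_mem_convexHull hx
  have hcard : Fintype.card ι ≤ Fintype.card (Fin (d + 1)) := by
    refine hind.card_le_finrank_succ.trans ?_
    rw [Fintype.card_fin]
    have := Submodule.finrank_le (vectorSpan ℝ (Set.range z))
    rw [finrank_euclideanSpace_fin] at this
    omega
  obtain ⟨e⟩ := Function.Embedding.nonempty_of_card_le hcard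
  have hext : ∀ i ∉ Set.range e, Function.extend e w 0 i = 0 := fun i hi =>
    Function.extend_apply' _ _ _ (by simpa using hi)
  -- Superfluous slots get weight zero and the dummy point `z₀`. A fixed number of points is what
  -- makes the later compactness argument possible.
  refine ⟨Function.extend e w 0, Function.extend e z fun _ => z₀, ⟨fun i => ?_, ?_⟩, fun i => ?_, ?_⟩
  · by_cases hi : i ∈ Set.range e
    · obtain ⟨j, rfl⟩ := hi
      rw [e.injective.extend_apply]
      exact (hw j).le
    · exact (hext i hi).ge
  · rw [← hw1]
    exact (Fintype.sum_of_injective e e.injective _ _ hext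
      fun i => (e.injective.extend_apply _ _ _).symm).symm
  · by_cases hi : i ∈ Set.range e
    · obtain ⟨j, rfl⟩ := hi
      rw [e.injective.extend_apply]
      exact hz ⟨j, rfl⟩
    · rw [Function.extend_apply' _ _ _ (by simpa using hi)]
      exact hz₀
  · rw [← hwz]
    refine (Fintype.sum_of_injective e e.injective _ _ (fun i hi => ?_) fun i => ?_).symm
    · rw [hext i hi, zero_smul]
    · rw [e.injective.extend_apply, e.injective.extend_apply]

/-- `clarkeEpsSubdiff f ε` is upper semicontinuous and compact-valued. -/
theorem exists_tendsto_subseq_clarkeEpsSubdiff {d : ℕ} {f : Vec d → ℝ} {C : ℝ≥0}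
    (hf : LipschitzWith C f) {ε : ℝ} {x a : ℕ → Vec d} {w : Vec d} (hx : Tendsto x atTop (𝓝 w))
    (ha : ∀ k, a k ∈ clarkeEpsSubdiff f ε (x k)) :
    ∃ a₀ ∈ clarkeEpsSubdiff f ε w, ∃ φ : ℕ → ℕ, StrictMono φ ∧ Tendsto (a ∘ φ) atTop (𝓝 a₀) := by
  choose l g hl hg hsum using fun k => exists_stdSimplex_of_mem_convexHull (ha k)
  simp only [mem_iUnion, exists_prop] at hg
  choose y hy hgy using hg
  obtain ⟨R, hR⟩ := (Metric.isBounded_range_of_tendsto x hx).subset_closedBall 0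
  -- Weights, subgradients and base points all range over compact sets, so one subsequence serves
  -- them all.
  have hK : IsCompact (stdSimplex ℝ (Fin (d + 1)) ×ˢ
      ((univ.pi fun _ : Fin (d + 1) => Metric.closedBall (0 : Vec d) C) ×ˢ
        (univ.pi fun _ : Fin (d + 1) => Metric.closedBall (0 : Vec d) (R + ε)))) :=
    (isCompact_stdSimplex ℝ _).prod ((isCompact_univ_pi fun _ => isCompact_closedBall _ _).prod
      (isCompact_univ_pi fun _ => isCompact_closedBall _ _))
  obtain ⟨⟨l₀, g₀, y₀⟩, hmem, φ, hφ, hlim⟩ := hK.tendsto_subseq (x := fun k => (l k, g k, y k))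
    fun k => by
      refine ⟨hl k, fun i _ => ?_, fun i _ => ?_⟩
      · simpa using norm_le_of_mem_clarkeSubdiff hf (hgy k i)
      · have h1 : dist (y k i) (x k) ≤ ε := hy k i
        have h2 : dist (x k) 0 ≤ R := hR ⟨k, rfl⟩
        exact (dist_triangle _ _ _).trans (by linarith)
  rw [Prod.tendsto_iff, Prod.tendsto_iff] at hlim
  obtain ⟨hl₀, hg₀, hy₀⟩ := hlim
  rw [tendsto_pi_nhds] at hl₀ hg₀ hy₀
  refine ⟨∑ i, l₀ i • g₀ i, ?_, φ, hφ, ?_⟩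
  · refine (convex_convexHull ℝ _).sum_mem (fun i _ => hmem.1.1 i) hmem.1.2 fun i _ =>
      subset_convexHull ℝ _ ?_
    simp only [mem_iUnion, exists_prop]
    refine ⟨y₀ i, ?_, mem_clarkeSubdiff_of_tendsto (hy₀ i) (hg₀ i) fun k => hgy (φ k) i⟩
    rw [Metric.mem_closedBall]
    exact le_of_tendsto ((hy₀ i).dist (hx.comp hφ.tendsto_atTop))
      (Eventually.of_forall fun k => hy (φ k) i)
  · have : Tendsto (fun k => ∑ i, l (φ k) i • g (φ k) i) atTop (𝓝 (∑ i, l₀ i • g₀ i)) :=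
      tendsto_finsetSum _ fun i _ => (hl₀ i).smul (hg₀ i)
    exact this.congr fun k => hsum (φ k)

theorem isClosed_clarkeEpsSubdiff {d : ℕ} {f : Vec d → ℝ} {C : ℝ≥0} (hf : LipschitzWith C f)
    (ε : ℝ) (w : Vec d) : IsClosed (clarkeEpsSubdiff f ε w) := by
  refine IsSeqClosed.isClosed fun a a₁ ha hlim => ?_
  obtain ⟨a₀, ha₀, φ, hφ, hφlim⟩ :=
    exists_tendsto_subseq_clarkeEpsSubdiff hf (tendsto_const_nhds (x := w)) ha
  rwa [← tendsto_nhds_unique hφlim (hlim.comp hφ.tendsto_atTop)]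

/-- An average of points of a closed convex set stays in the set; here the points are the gradients
of `f` at `w + u`. -/
theorem gradient_smooth_mem_clarkeEpsSubdiff {d : ℕ} {f : Vec d → ℝ} {C : ℝ≥0}
    (hf : LipschitzWith C f) {α : ℝ} (hα : 0 < α) (w : Vec d) :
    ∇ (smooth f α) w ∈ clarkeEpsSubdiff f (√d * (α / 2)) w := by
  have := uniformBox_isProbabilityMeasure d hα
  obtain ⟨h1, h2⟩ := gradient_smooth hf hα w
  rw [h2]
  refine (convex_convexHull ℝ _).integral_mem (isClosed_clarkeEpsSubdiff hf _ w) ?_ h1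
  filter_upwards [LipschitzWith.ae_uniformBox_differentiableAt hf w, ae_norm_le_uniformBox d hα]
    with u hu hu'
  refine subset_convexHull ℝ _ ?_
  simp only [mem_iUnion, exists_prop]
  exact ⟨w + u, by simpa using hu', gradient_mem_clarkeSubdiff hu⟩

theorem clarkeEpsSubdiff_congr {d : ℕ} {f g : Vec d → ℝ} {ε : ℝ} {w : Vec d}
    (h : ∀ x ∈ Metric.closedBall w ε, f =ᶠ[𝓝 x] g) :
    clarkeEpsSubdiff f ε w = clarkeEpsSubdiff g ε w := by
  unfold clarkeEpsSubdiff
  congr 1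
  exact iUnion₂_congr fun x hx => clarkeSubdiff_congr (h x hx)

/-! ### Mini-batches -/

/-- Coordinate by coordinate, averaging `M` independent copies divides the variance by `M`, and a
variance is at most the second moment. -/
theorem lintegral_minibatch_error_le {d M : ℕ} {Z : Type*} [MeasurableSpace Z] {ν : Measure Z}
    [IsProbabilityMeasure ν] (hM : 0 < M) {g : Z → Vec d} {m : Vec d} {σ2 : ℝ}
    (hg : MemLp g 2 ν) (hm : ∀ c, ∫ z, g z c ∂ν = m c) (hσ : ∫ z, ‖g z‖ ^ 2 ∂ν ≤ σ2) :
    ∫⁻ s : Fin M → Z, ENNReal.ofReal (‖(M : ℝ)⁻¹ • ∑ i, g (s i) - m‖ ^ 2)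
      ∂(Measure.pi fun _ => ν) ≤ ENNReal.ofReal (σ2 / M) := by
  have hM' : (0 : ℝ) < M := by exact_mod_cast hM
  have hgc : ∀ c, MemLp (fun z => g z c) 2 ν := fun c =>
    hg.continuousLinearMap_comp (EuclideanSpace.proj (𝕜 := ℝ) c)
  set μ := Measure.pi fun _ : Fin M => ν with hμ
  have hX : ∀ c, MemLp (∑ i, fun s : Fin M → Z => g (s i) c) 2 μ := fun c =>
    memLp_finsetSum' _ fun i _ => (hgc c).comp_measurePreserving (measurePreserving_eval _ i)
  have hmean : ∀ c, ∫ s, ((M : ℝ)⁻¹ • ∑ i, fun s : Fin M → Z => g (s i) c) s ∂μ = m c := by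
    intro c
    have h1 : ∀ i : Fin M, ∫ s : Fin M → Z, g (s i) c ∂μ = m c := fun i => by
      rw [← hm c]
      exact integral_comp_eval (μ := fun _ : Fin M => ν) (i := i) (f := fun z => g z c)
        (hgc c).aestronglyMeasurable
    simp only [Pi.smul_apply, Finset.sum_apply, smul_eq_mul]
    have h2 : ∀ i ∈ Finset.univ, Integrable (fun s : Fin M → Z => g (s i) c) μ := fun i _ =>
      ((hgc c).comp_measurePreserving (measurePreserving_eval _ i)).integrable one_le_two
    rw [integral_const_mul, integral_finsetSum _ h2]
    simp only [h1, Finset.sum_const, Finset.card_univ, Fintype.card_fin, nsmul_eq_mul]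
    field_simp
  have hvar : ∀ c, Var[(M : ℝ)⁻¹ • ∑ i, fun s : Fin M → Z => g (s i) c; μ] ≤
      (M : ℝ)⁻¹ * ∫ z, g z c ^ 2 ∂ν := by
    intro c
    rw [variance_smul, variance_sum_pi fun _ => hgc c]
    simp only [Finset.sum_const, Finset.card_univ, Fintype.card_fin, nsmul_eq_mul]
    have := variance_le_expectation_sq (hgc c).aestronglyMeasurable
    calc _ = (M : ℝ)⁻¹ * Var[fun z => g z c; ν] := by field_simp
      _ ≤ _ := by gcongr; exact this
  have hsq : ∀ s : Fin M → Z, ‖(M : ℝ)⁻¹ • ∑ i, g (s i) - m‖ ^ 2 =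
      ∑ c, (((M : ℝ)⁻¹ • ∑ i, fun s : Fin M → Z => g (s i) c) s -
        ∫ s, ((M : ℝ)⁻¹ • ∑ i, fun s : Fin M → Z => g (s i) c) s ∂μ) ^ 2 := fun s => by
    simp only [hmean, EuclideanSpace.norm_sq_eq, Real.norm_eq_abs, sq_abs]
    simp
  have hint : ∀ c, Integrable (fun s => (((M : ℝ)⁻¹ • ∑ i, fun s : Fin M → Z => g (s i) c) s -
        ∫ s, ((M : ℝ)⁻¹ • ∑ i, fun s : Fin M → Z => g (s i) c) s ∂μ) ^ 2) μ := fun c =>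
    (((hX c).const_smul (M : ℝ)⁻¹).sub (memLp_const _)).integrable_sq
  simp only [hsq]
  rw [← ofReal_integral_eq_lintegral_ofReal (integrable_finsetSum _ fun c _ => hint c)
    (Eventually.of_forall fun s => Finset.sum_nonneg fun c _ => sq_nonneg _),
    integral_finsetSum _ fun c _ => hint c]
  refine ENNReal.ofReal_le_ofReal ?_
  calc _ = ∑ c, Var[(M : ℝ)⁻¹ • ∑ i, fun s : Fin M → Z => g (s i) c; μ] := by
        refine Finset.sum_congr rfl fun c _ => ?_
        rw [variance_eq_integral ((hX c).const_smul (M : ℝ)⁻¹).aestronglyMeasurable.aemeasurable]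
    _ ≤ ∑ c, (M : ℝ)⁻¹ * ∫ z, g z c ^ 2 ∂ν := Finset.sum_le_sum fun c _ => hvar c
    _ = (M : ℝ)⁻¹ * ∫ z, ‖g z‖ ^ 2 ∂ν := by
        rw [← Finset.mul_sum, ← integral_finsetSum _ fun c _ => (hgc c).integrable_sq]
        simp only [EuclideanSpace.norm_sq_eq, Real.norm_eq_abs, sq_abs]
    _ ≤ (M : ℝ)⁻¹ * σ2 := by gcongr
    _ = σ2 / M := by ring

/-! ### The trajectory of the iterates -/

section Trajectory

variable {d K M : ℕ} {Z : Type*}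

/-- The iterates of the projected mini-batch method; they stay constant after `K` steps. -/
noncomputable def iterates (proj : ℕ → Vec d → Vec d) (g : Vec d → Z → Vec d) (η : ℝ) (w₁ : Vec d)
    (b : Fin K → Fin M → Z) : ℕ → Vec d
  | 0 => w₁
  | k + 1 =>
    let w := iterates proj g η w₁ b k
    if h : k < K then proj k (w - η • ((M : ℝ)⁻¹ • ∑ i, g w (b ⟨k, h⟩ i))) else w

variable {proj : ℕ → Vec d → Vec d} {g g' : Vec d → Z → Vec d} {η : ℝ} {w₁ : Vec d}

theorem iterates_succ (b : Fin K → Fin M → Z) (k : Fin K) :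
    iterates proj g η w₁ b (k + 1) = proj k (iterates proj g η w₁ b k -
      η • ((M : ℝ)⁻¹ • ∑ i, g (iterates proj g η w₁ b k) (b k i))) := by
  rw [iterates]
  simp

theorem iterates_mem {T : Set (Vec d)} (hw₁ : w₁ ∈ T) (hproj : ∀ j x, proj j x ∈ T)
    (b : Fin K → Fin M → Z) (k : ℕ) : iterates proj g η w₁ b k ∈ T := by
  induction k with
  | zero => exact hw₁
  | succ k ih =>
    rw [iterates]
    split_ifs with h
    · exact hproj _ _
    · exact ih

/-- The iterate with index `j` reads only the batches with index below `j`. This expresses the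
independence of the current iterate from the current batch. -/
theorem iterates_update (b : Fin K → Fin M → Z) (k : Fin K) (s : Fin M → Z) {j : ℕ} (hj : j ≤ k) :
    iterates proj g η w₁ (Function.update b k s) j = iterates proj g η w₁ b j := by
  induction j with
  | zero => rfl
  | succ j ih =>
    have hjK : j < K := by omega
    have hne : (⟨j, hjK⟩ : Fin K) ≠ k := fun h => by simp [← h] at hj
    rw [iterates, iterates]
    simp only [ih (by omega), hjK, dite_true, Function.update_of_ne hne]

theorem iterates_congr {T : Set (Vec d)} (hw₁ : w₁ ∈ T) (hproj : ∀ j x, proj j x ∈ T)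
    {b : Fin K → Fin M → Z} (h : ∀ w ∈ T, ∀ k i, g w (b k i) = g' w (b k i)) (k : ℕ) :
    iterates proj g η w₁ b k = iterates proj g' η w₁ b k := by
  induction k with
  | zero => rfl
  | succ k ih =>
    rw [iterates, iterates]
    have := iterates_mem (g := g') (η := η) hw₁ hproj b k
    simp only [ih, h _ this]

theorem measurable_iterates [MeasurableSpace Z] (hproj : ∀ j, Measurable (proj j))
    (hg : Measurable fun q : Vec d × Z => g q.1 q.2) (k : ℕ) :
    Measurable fun b : Fin K → Fin M → Z => iterates proj g η w₁ b k := by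
  induction k with
  | zero => exact measurable_const
  | succ k ih =>
    by_cases h : k < K
    · simp only [iterates, h, dite_true]
      have hs : ∀ i : Fin M, Measurable fun b : Fin K → Fin M → Z =>
          g (iterates proj g η w₁ b k) (b ⟨k, h⟩ i) := fun i =>
        hg.comp (ih.prodMk ((measurable_pi_apply i).comp (measurable_pi_apply (⟨k, h⟩ : Fin K))))
      refine (hproj k).comp (ih.sub ?_)
      fun_prop
    · simpa only [iterates, h, dite_false] using ih

/-- Resampling batch `k` preserves the law and leaves the iterate unchanged, so by Fubini the
mini-batch bound applies at a frozen point. -/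
theorem lintegral_iterates_error_le [MeasurableSpace Z] {ν : Measure Z} [IsProbabilityMeasure ν]
    (hM : 0 < M) {T : Set (Vec d)} {G : Vec d → Vec d} {σ2 : ℝ} (hw₁ : w₁ ∈ T)
    (hprojT : ∀ j x, proj j x ∈ T) (hproj : ∀ j, Measurable (proj j))
    (hg : Measurable fun q : Vec d × Z => g q.1 q.2) (hG : Measurable G)
    (hLp : ∀ w ∈ T, MemLp (g w) 2 ν) (hmean : ∀ w ∈ T, ∀ c, ∫ z, g w z c ∂ν = G w c)
    (hσ : ∀ w ∈ T, ∫ z, ‖g w z‖ ^ 2 ∂ν ≤ σ2) (k : Fin K) :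
    Measurable (fun b : Fin K → Fin M → Z => ENNReal.ofReal (‖(M : ℝ)⁻¹ • ∑ i,
        g (iterates proj g η w₁ b k) (b k i) - G (iterates proj g η w₁ b k)‖ ^ 2)) ∧
    ∫⁻ b : Fin K → Fin M → Z, ENNReal.ofReal (‖(M : ℝ)⁻¹ • ∑ i,
        g (iterates proj g η w₁ b k) (b k i) - G (iterates proj g η w₁ b k)‖ ^ 2)
      ∂(Measure.pi fun _ => Measure.pi fun _ => ν) ≤ ENNReal.ofReal (σ2 / M) := by
  have hWm := measurable_iterates (K := K) (M := M) (w₁ := w₁) (η := η) hproj hg k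
  have hΨ : Measurable (fun b : Fin K → Fin M → Z => ENNReal.ofReal (‖(M : ℝ)⁻¹ • ∑ i,
        g (iterates proj g η w₁ b k) (b k i) - G (iterates proj g η w₁ b k)‖ ^ 2)) := by
    have hs : ∀ i : Fin M, Measurable fun b : Fin K → Fin M → Z =>
        g (iterates proj g η w₁ b k) (b k i) := fun i =>
      hg.comp (hWm.prodMk ((measurable_pi_apply i).comp (measurable_pi_apply k)))
    have hGW : Measurable fun b : Fin K → Fin M → Z => G (iterates proj g η w₁ b k) := hG.comp hWm
    fun_prop
  refine ⟨hΨ, ?_⟩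
  have hp := measurePreserving_update_pi
    (fun _ : Fin K => Measure.pi fun _ : Fin M => ν) k
  have hΨ' := hΨ.comp hp.measurable
  simp only [Function.comp_def] at hΨ'
  rw [← hp.lintegral_comp hΨ, lintegral_prod _ hΨ'.aemeasurable]
  simp only [iterates_update _ k _ le_rfl, Function.update_self]
  calc _ ≤ ∫⁻ _b : Fin K → Fin M → Z, ENNReal.ofReal (σ2 / M)
        ∂(Measure.pi fun _ => Measure.pi fun _ => ν) := by
        refine lintegral_mono fun b => ?_
        have hw := iterates_mem (g := g) (η := η) hw₁ hprojT b k
        exact lintegral_minibatch_error_le hM (hLp _ hw) (hmean _ hw) (hσ _ hw)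
    _ = _ := by simp

/-- The convergence bound for the sum of the squared stationarity residuals. -/
theorem sum_lintegral_sq_infEDist_le [MeasurableSpace Z] {ν : Measure Z} [IsProbabilityMeasure ν]
    (hM : 0 < M) {T : Set (Vec d)} (hT : IsClosed T) {φ : Vec d → ℝ} {G : Vec d → Vec d}
    {L ρ Δ σ2 : ℝ} (hL : 0 < L) (hρ : 1 < ρ) (hφ : ∀ x, HasGradientAt φ (G x) x)
    (hGlip : ∀ x y, ‖G x - G y‖ ≤ L * ‖x - y‖) (hw₁ : w₁ ∈ T)
    (hproj : ∀ j, IsProjSelection T (proj j)) (hΔ : ∀ w ∈ T, φ w₁ - φ w ≤ Δ) (hΔ0 : 0 ≤ Δ)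
    (hg : Measurable fun q : Vec d × Z => g q.1 q.2)
    (hLp : ∀ w ∈ T, MemLp (g w) 2 ν) (hmean : ∀ w ∈ T, ∀ c, ∫ z, g w z c ∂ν = G w c)
    (hσ : ∀ w ∈ T, ∫ z, ‖g w z‖ ^ 2 ∂ν ≤ σ2) (hσ0 : 0 ≤ σ2) :
    ∑ k : Fin K, ∫⁻ b : Fin K → Fin M → Z,
      Metric.infEDist 0 ({G (iterates proj g (2 / (3 * ρ * L)) w₁ b (k + 1))} +
        normalCone T (iterates proj g (2 / (3 * ρ * L)) w₁ b (k + 1))) ^ 2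
      ∂(Measure.pi fun _ => Measure.pi fun _ => ν) ≤
    ENNReal.ofReal (C₁ ρ * (L * Δ) + C₂ ρ * (K * (σ2 / M))) := by
  have hprojT : ∀ j x, proj j x ∈ T := fun j x => ((hproj j).2 x).1
  have hGc : Continuous G := (LipschitzWith.of_dist_le_mul (K := L.toNNReal) fun x y => by
    rw [dist_eq_norm, dist_eq_norm, Real.coe_toNNReal _ hL.le]; exact hGlip x y).continuous
  have hρ' : 0 < ρ - 1 := by linarith
  -- The one-step bound has `1 + ρ` where `C₁` and `C₂` have `1 + 3 * ρ`, so the stated constants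
  -- dominate it.
  have hcle : 2 * (1 + ρ) / (ρ - 1) ≤ 2 * (1 + 3 * ρ) / (ρ - 1) := by gcongr; linarith
  have hc0 : 0 < 2 * (1 + ρ) / (ρ - 1) := by positivity
  have hC₁ : 2 * (1 + ρ) / (ρ - 1) + 3 * ρ ≤ C₁ ρ := by unfold C₁; linarith
  have hC₂ : 2 * (1 + ρ) / (ρ - 1) + 3 ≤ C₂ ρ := by
    have : C₂ ρ = 2 * (1 + 3 * ρ) / (ρ - 1) + 3 := by unfold C₂; ring
    linarith
  have hC₂0 : 0 < C₂ ρ := by linarith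
  set η := 2 / (3 * ρ * L)
  set W : (Fin K → Fin M → Z) → ℕ → Vec d := iterates proj g η w₁ with hW
  have hWT : ∀ b k, W b k ∈ T := iterates_mem hw₁ hprojT
  set e : (Fin K → Fin M → Z) → Fin K → ℝ := fun b k =>
    ‖(M : ℝ)⁻¹ • ∑ i, g (W b k) (b k i) - G (W b k)‖ ^ 2 with he
  set h : Vec d → ℝ≥0∞ := fun w => Metric.infEDist 0 ({G w} + normalCone T w) with hh
  have hhm : Measurable h := measurable_infEDist_add_normalCone hT fun x a w hx _ ha =>
    ⟨G w, rfl, id, strictMono_id, by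
      have : a = G ∘ x := funext fun k => ha k
      rw [this]
      exact (hGc.tendsto w).comp hx⟩
  have hpt : ∀ b, ∑ k : Fin K, h (W b (k + 1)) ^ 2 ≤
      ENNReal.ofReal (C₁ ρ * (L * Δ)) + ∑ k, ENNReal.ofReal (C₂ ρ) * ENNReal.ofReal (e b k) := by
    intro b
    have hstep : ∀ k : Fin K, _ := fun k => sq_infEDist_le_of_step hL hρ hφ hGlip (hWT b k)
      (w' := W b (k + 1)) (g := (M : ℝ)⁻¹ • ∑ i, g (W b k) (b k i))
      (by rw [hW, iterates_succ]; exact (hproj k).2 _)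
    calc _ ≤ ∑ k : Fin K, ENNReal.ofReal _ := Finset.sum_le_sum fun k _ => (hstep k).2
      _ = ENNReal.ofReal _ := (ENNReal.ofReal_sum_of_nonneg fun k _ => (hstep k).1).symm
      _ = ENNReal.ofReal ((2 * (1 + ρ) / (ρ - 1) + 3 * ρ) * L * (φ w₁ - φ (W b K)) +
            ∑ k, (2 * (1 + ρ) / (ρ - 1) + 3) * e b k) := by
          -- The decreases telescope, leaving only the first and last values of `φ`.
          rw [Finset.sum_add_distrib, ← Finset.mul_sum,
            Fin.sum_univ_eq_sum_range (fun k => φ (W b k) - φ (W b (k + 1))) K,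
            Finset.sum_range_sub']
          rfl
      _ ≤ ENNReal.ofReal (C₁ ρ * (L * Δ) + ∑ k, C₂ ρ * e b k) := by
          refine ENNReal.ofReal_le_ofReal (add_le_add ?_ (Finset.sum_le_sum fun k _ => ?_))
          · calc _ ≤ (2 * (1 + ρ) / (ρ - 1) + 3 * ρ) * L * Δ := by
                  gcongr; exact hΔ _ (hWT b K)
              _ ≤ C₁ ρ * L * Δ := by gcongr
              _ = _ := by ring
          · have : 0 ≤ e b k := sq_nonneg _
            gcongr
      _ ≤ _ := by
          refine ENNReal.ofReal_add_le.trans ?_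
          rw [ENNReal.ofReal_sum_of_nonneg fun k _ => mul_nonneg hC₂0.le (sq_nonneg _)]
          simp only [ENNReal.ofReal_mul hC₂0.le]
          rfl
  have herr := fun k => lintegral_iterates_error_le (η := η) (ν := ν) (K := K) hM hw₁ hprojT
    (fun j => (hproj j).1) hg hGc.measurable hLp hmean hσ k
  have hhW : ∀ k ∈ Finset.univ, Measurable fun b : Fin K → Fin M → Z =>
      h (W b ((k : Fin K) + 1)) ^ 2 := fun k _ =>
    (hhm.comp (measurable_iterates (fun j => (hproj j).1) hg _)).pow_const 2
  change ∑ k : Fin K, ∫⁻ b, h (W b (k + 1)) ^ 2 ∂_ ≤ _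
  rw [← lintegral_finsetSum _ hhW]
  calc _ ≤ ∫⁻ b, (ENNReal.ofReal (C₁ ρ * (L * Δ)) +
          ∑ k, ENNReal.ofReal (C₂ ρ) * ENNReal.ofReal (e b k))
          ∂(Measure.pi fun _ => Measure.pi fun _ => ν) := lintegral_mono hpt
    _ = ENNReal.ofReal (C₁ ρ * (L * Δ)) + ∑ k, ENNReal.ofReal (C₂ ρ) *
          ∫⁻ b, ENNReal.ofReal (e b k) ∂(Measure.pi fun _ => Measure.pi fun _ => ν) := by
        rw [lintegral_add_left measurable_const,
          lintegral_finsetSum _ fun k _ => (herr k).1.const_mul _]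
        simp only [lintegral_const, measure_univ, mul_one]
        congr 1
        exact Finset.sum_congr rfl fun k _ => lintegral_const_mul _ (herr k).1
    _ ≤ ENNReal.ofReal (C₁ ρ * (L * Δ)) + ∑ _k : Fin K, ENNReal.ofReal (C₂ ρ) *
          ENNReal.ofReal (σ2 / M) := by
        gcongr with k _
        exact (herr k).2
    _ = _ := by
        have hC₁0 : 0 < C₁ ρ := by linarith
        rw [ENNReal.ofReal_add (by positivity) (by positivity), Finset.sum_const, Finset.card_univ,
          Fintype.card_fin, nsmul_eq_mul, ← ENNReal.ofReal_mul hC₂0.le, ← ENNReal.ofReal_natCast,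
          ← ENNReal.ofReal_mul (Nat.cast_nonneg _)]
        congr 2
        ring

end Trajectory

/-! ### Runs of the algorithm -/

theorem batchSum_ofFn {d M : ℕ} {Z : Type*} (g : Z → Vec d) (s : Fin M → Z) :
    batchSum g (List.ofFn s) = (∑ i, g (s i), M) := by
  have h : ∀ (l : List Z) (a : Vec d) (n : ℕ),
      l.foldl (fun acc z => (acc.1 + g z, acc.2 + 1)) (a, n) =
        (a + (l.map g).sum, n + l.length) := by
    intro l
    induction l with
    | nil => simp
    | cons z l ih =>
      intro a n
      rw [List.foldl_cons, ih]
      simp [add_assoc, add_comm 1]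
  rw [batchSum, h]
  simp [List.map_ofFn, List.sum_ofFn]

theorem foldl_step_take {d p K M : ℕ} (m : Setting) (F : Vec d → Vec p → ℝ)
    (gradF : Vec d → Vec p → Vec d) (proj : ℕ → Vec d → Vec d) (α η : ℝ) (w₁ : Vec d)
    (b : Fin K → Fin M → Vec d × Vec p) {n : ℕ} (hn : n ≤ K) :
    ((List.ofFn b).take n).foldl (step m F gradF proj α η) ⟨w₁, 0, 0⟩ =
      ⟨iterates proj (fun w z => gradEstimate m F gradF α w z.1 z.2) η w₁ b n, n * M, n⟩ := by
  induction n with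
  | zero => simp [iterates]
  | succ n ih =>
    have hn' : n < (List.ofFn b).length := by simpa using hn
    rw [← List.take_concat_get' _ _ hn', List.foldl_append, ih (by omega), List.foldl_cons,
      List.foldl_nil, List.getElem_ofFn, step]
    simp only [batchSum_ofFn]
    rw [iterates_succ b ⟨n, hn⟩, div_eq_mul_inv, ← smul_smul]
    simp [add_mul]

theorem run_eq {d p K M : ℕ} (m : Setting) (F : Vec d → Vec p → ℝ)
    (gradF : Vec d → Vec p → Vec d) (proj : ℕ → Vec d → Vec d) (α η : ℝ) (w₁ : Vec d)
    (seed : Seed d p K M) :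
    run m F gradF proj α η w₁ seed =
      ⟨iterates proj (fun w z => gradEstimate m F gradF α w z.1 z.2) η w₁ seed.2
        (min (seed.1 - 1) K), min (seed.1 - 1) K * M, min (seed.1 - 1) K⟩ := by
  rw [← foldl_step_take m F gradF proj α η w₁ seed.2 (min_le_right _ _), run]
  congr 1
  rcases le_total (seed.1 - 1) K with h | h
  · rw [min_eq_left h]
  · rw [min_eq_right h, List.take_of_length_le (by simpa using h), List.take_of_length_le (by simp)]

/-- The iterates freeze after `K` steps, so truncating the step count at `K` does not affect the
output point. -/
theorem iterates_min {d K M : ℕ} {Z : Type*} (proj : ℕ → Vec d → Vec d) (g : Vec d → Z → Vec d)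
    (η : ℝ) (w₁ : Vec d) (b : Fin K → Fin M → Z) (n : ℕ) :
    iterates proj g η w₁ b (min n K) = iterates proj g η w₁ b n := by
  induction n with
  | zero => simp
  | succ n ih =>
    by_cases h : n < K
    · rw [min_eq_left h]
    · rw [min_eq_right (by omega)]
      rw [min_eq_right (by omega)] at ih
      rw [ih, iterates]
      simp [h]

theorem lintegral_seedLaw {d p K M : ℕ} {α : ℝ} (hα : 0 < α) (Pξ : Measure (Vec p))
    [IsProbabilityMeasure Pξ] {H : Seed d p K M → ℝ≥0∞} (hH : Measurable H) :
    ∫⁻ seed, H seed ∂(seedLaw d α Pξ K M) = (K : ℝ≥0∞)⁻¹ * ∑ k : Fin K, ∫⁻ b, H (k + 2, b)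
      ∂(Measure.pi fun _ : Fin K => Measure.pi fun _ : Fin M => (uniformBox d α).prod Pξ) := by
  have := uniformBox_isProbabilityMeasure d hα
  rw [seedLaw, lintegral_prod _ hH.aemeasurable, uniformOn, ProbabilityTheory.cond,
    lintegral_smul_measure, ← Finset.coe_Icc, lintegral_finset, Measure.count_apply_finset]
  simp only [Measure.count_singleton, mul_one, Nat.card_Icc, smul_eq_mul]
  congr 1
  -- The stopping index is `k + 2` with `k < K`, so the output is the iterate after `k + 1` steps,
  -- matching the summed residuals.
  rw [Fin.sum_univ_eq_sum_range (fun k => ∫⁻ b, H (k + 2, b)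
      ∂(Measure.pi fun _ : Fin K => Measure.pi fun _ : Fin M => (uniformBox d α).prod Pξ)) K,
    Finset.sum_bij' (fun r _ => r - 2) (fun k _ => k + 2)]
  · intro r hr; rw [Finset.mem_Icc] at hr; rw [Finset.mem_range]; omega
  · intro r hr; rw [Finset.mem_range] at hr; rw [Finset.mem_Icc]; omega
  · intro r hr; rw [Finset.mem_Icc] at hr; omega
  · intro r hr; omega
  · intro r hr; rw [Finset.mem_Icc] at hr; rw [Nat.sub_add_cancel hr.1]

/-- AM–GM in place of Jensen: integrating it turns a mean square of at most `ε²` into a mean of at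
most `ε / 2 + ε / 2`, including where `a` is infinite. -/
theorem ENNReal.le_mul_sq_add {ε : ℝ} (hε : 0 < ε) (a : ℝ≥0∞) :
    a ≤ ENNReal.ofReal (1 / (2 * ε)) * a ^ 2 + ENNReal.ofReal (ε / 2) := by
  by_cases ha : a = ⊤
  · have : ENNReal.ofReal (1 / (2 * ε)) ≠ 0 := by simp [hε]
    rw [ha, ENNReal.top_pow two_ne_zero, ENNReal.mul_top this, top_add]
  · lift a to NNReal using ha
    rw [← ENNReal.ofReal_coe_nnreal, ← ENNReal.ofReal_pow a.coe_nonneg, ← ENNReal.ofReal_mul (by positivity),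
      ← ENNReal.ofReal_add (by positivity) (by positivity)]
    refine ENNReal.ofReal_le_ofReal ?_
    rw [one_div_mul_eq_div, div_add_div _ _ (by positivity) (by positivity),
      le_div_iff₀ (by positivity)]
    nlinarith [sq_nonneg ((a : ℝ) - ε)]

theorem lintegral_seedLaw_le {d p K M : ℕ} {α : ℝ} (hα : 0 < α) (Pξ : Measure (Vec p))
    [IsProbabilityMeasure Pξ] (hK : 0 < K) {H : Seed d p K M → ℝ≥0∞} (hH : Measurable H) {ε : ℝ}
    (hε : 0 < ε) (hsum : ∑ k : Fin K, ∫⁻ b, H (k + 2, b) ^ 2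
      ∂(Measure.pi fun _ : Fin K => Measure.pi fun _ : Fin M => (uniformBox d α).prod Pξ) ≤
        ENNReal.ofReal (K * ε ^ 2)) :
    ∫⁻ seed, H seed ∂(seedLaw d α Pξ K M) ≤ ENNReal.ofReal ε := by
  have := uniformBox_isProbabilityMeasure d hα
  have hK' : (0 : ℝ) < K := by exact_mod_cast hK
  rw [lintegral_seedLaw hα Pξ hH]
  set μ := Measure.pi fun _ : Fin K => Measure.pi fun _ : Fin M => (uniformBox d α).prod Pξ
  have hc : ENNReal.ofReal (1 / (2 * ε)) * ENNReal.ofReal (K * ε ^ 2) =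
      ENNReal.ofReal (K * (ε / 2)) := by
    rw [← ENNReal.ofReal_mul (by positivity)]
    congr 1
    field_simp
  have hHk : ∀ k : Fin K, Measurable fun b => H (k + 2, b) := fun k =>
    hH.comp measurable_prodMk_left
  calc (K : ℝ≥0∞)⁻¹ * ∑ k : Fin K, ∫⁻ b, H (k + 2, b) ∂μ
    _ ≤ (K : ℝ≥0∞)⁻¹ * ∑ k : Fin K, (ENNReal.ofReal (1 / (2 * ε)) * ∫⁻ b, H (k + 2, b) ^ 2 ∂μ +
          ENNReal.ofReal (ε / 2)) := by
        gcongr with k _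
        refine (lintegral_mono fun b => ENNReal.le_mul_sq_add hε _).trans_eq ?_
        rw [lintegral_add_right _ measurable_const, lintegral_const_mul _ ((hHk k).pow_const 2)]
        simp
    _ ≤ (K : ℝ≥0∞)⁻¹ * (ENNReal.ofReal (1 / (2 * ε)) * ENNReal.ofReal (K * ε ^ 2) +
          K * ENNReal.ofReal (ε / 2)) := by
        rw [Finset.sum_add_distrib, ← Finset.mul_sum, Finset.sum_const, Finset.card_univ,
          Fintype.card_fin, nsmul_eq_mul]
        gcongr
    _ = (K : ℝ≥0∞)⁻¹ * ENNReal.ofReal (K * ε) := by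
        rw [hc, ← ENNReal.ofReal_natCast, ← ENNReal.ofReal_mul hK'.le,
          ← ENNReal.ofReal_add (by positivity) (by positivity)]
        congr 2
        ring
    _ = ENNReal.ofReal ε := by
        rw [ENNReal.ofReal_mul hK'.le, ENNReal.ofReal_natCast, ← mul_assoc,
          ENNReal.inv_mul_cancel (by exact_mod_cast hK.ne') (ENNReal.natCast_ne_top K), one_mul]

/-- The expected stationarity residual at the random index. -/
theorem lintegral_iterates_infEDist_le {d p K M : ℕ} {α : ℝ} (hα : 0 < α) (Pξ : Measure (Vec p))
    [IsProbabilityMeasure Pξ] (hM : 0 < M) (hK : 0 < K) {T : Set (Vec d)} (hT : IsClosed T)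
    {proj : ℕ → Vec d → Vec d} {g : Vec d → Vec d × Vec p → Vec d} {w₁ : Vec d}
    {φ : Vec d → ℝ} {G : Vec d → Vec d} {L ρ Δ σ2 ε : ℝ} (hL : 0 < L) (hρ : 1 < ρ)
    (hφ : ∀ x, HasGradientAt φ (G x) x) (hGlip : ∀ x y, ‖G x - G y‖ ≤ L * ‖x - y‖) (hw₁ : w₁ ∈ T)
    (hproj : ∀ j, IsProjSelection T (proj j)) (hΔ : ∀ w ∈ T, φ w₁ - φ w ≤ Δ) (hΔ0 : 0 ≤ Δ)
    (hg : Measurable fun q : Vec d × (Vec d × Vec p) => g q.1 q.2)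
    (hLp : ∀ w ∈ T, MemLp (g w) 2 ((uniformBox d α).prod Pξ))
    (hmean : ∀ w ∈ T, ∀ c, ∫ z, g w z c ∂((uniformBox d α).prod Pξ) = G w c)
    (hσ : ∀ w ∈ T, ∫ z, ‖g w z‖ ^ 2 ∂((uniformBox d α).prod Pξ) ≤ σ2) (hσ0 : 0 ≤ σ2)
    (hε : 0 < ε) (hKε : C₁ ρ * (L * Δ) ≤ K * (ε ^ 2 / 2)) (hMε : C₂ ρ * σ2 ≤ M * (ε ^ 2 / 2)) :
    Measurable (fun seed : Seed d p K M =>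
      iterates proj g (2 / (3 * ρ * L)) w₁ seed.2 (seed.1 - 1)) ∧
    ∫⁻ seed : Seed d p K M, Metric.infEDist 0
      ({G (iterates proj g (2 / (3 * ρ * L)) w₁ seed.2 (seed.1 - 1))} +
        normalCone T (iterates proj g (2 / (3 * ρ * L)) w₁ seed.2 (seed.1 - 1)))
      ∂(seedLaw d α Pξ K M) ≤ ENNReal.ofReal ε := by
  have := uniformBox_isProbabilityMeasure d hα
  have hGc : Continuous G := (LipschitzWith.of_dist_le_mul (K := L.toNNReal) fun x y => by
    rw [dist_eq_norm, dist_eq_norm, Real.coe_toNNReal _ hL.le]; exact hGlip x y).continuous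
  have hM' : (0 : ℝ) < M := by exact_mod_cast hM
  have hhm : Measurable fun w => Metric.infEDist 0 ({G w} + normalCone T w) :=
    measurable_infEDist_add_normalCone hT fun x a w hx _ ha =>
    ⟨G w, rfl, id, strictMono_id, by
      have : a = G ∘ x := funext fun k => ha k
      rw [this]
      exact (hGc.tendsto w).comp hx⟩
  have hWm : Measurable (fun seed : Seed d p K M =>
      iterates proj g (2 / (3 * ρ * L)) w₁ seed.2 (seed.1 - 1)) :=
    measurable_from_prod_countable_right fun r => by
      exact measurable_iterates (fun j => (hproj j).1) hg (r - 1)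
  have hsum := sum_lintegral_sq_infEDist_le (K := K) hM hT hL hρ hφ hGlip hw₁ hproj hΔ hΔ0 hg hLp
    hmean hσ hσ0
  have hbound : C₁ ρ * (L * Δ) + C₂ ρ * (K * (σ2 / M)) ≤ K * ε ^ 2 := by
    have h1 : C₂ ρ * σ2 / M ≤ ε ^ 2 / 2 := by
      rw [div_le_iff₀ hM']; linarith
    have h2 : C₂ ρ * (K * (σ2 / M)) = K * (C₂ ρ * σ2 / M) := by ring
    have h3 := mul_le_mul_of_nonneg_left h1 (Nat.cast_nonneg (α := ℝ) K)
    linarith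
  exact ⟨hWm, lintegral_seedLaw_le hα Pξ hK (hhm.comp hWm) hε
    (hsum.trans (ENNReal.ofReal_le_ofReal hbound))⟩

/-! ### Stochastic gradient estimates -/

/-- The hypotheses give joint measurability only over a subtype; extension by zero along a
measurable embedding makes it global. -/
theorem Measurable.indicator_fst {X Y E : Type*} [MeasurableSpace X] [MeasurableSpace Y]
    [MeasurableSpace E] [Zero E] {s : Set X} (hs : MeasurableSet s) {φ : X → Y → E}
    (h : Measurable fun q : s × Y => φ q.1 q.2) :
    Measurable ((s ×ˢ univ).indicator fun q : X × Y => φ q.1 q.2) := by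
  classical
  have he : MeasurableEmbedding (fun q : s × Y => ((q.1 : X), q.2)) :=
    (MeasurableEmbedding.subtype_coe hs).prodMap MeasurableEmbedding.id
  convert! he.measurable_extend h (measurable_const (a := (0 : E))) using 1
  ext q
  by_cases hq : q.1 ∈ s
  · rw [indicator_of_mem (by simpa using hq)]
    exact (he.injective.extend_apply (fun q : s × Y => φ q.1 q.2) _ (⟨q.1, hq⟩, q.2)).symm
  · rw [indicator_of_notMem (by simpa using hq), Function.extend_apply']
    rintro ⟨a, rfl⟩
    exact hq a.1.2

section Loss

variable {d p : ℕ} {Pξ : Measure (Vec p)} {F : Vec d → Vec p → ℝ} {L : Vec p → ℝ} {κ β : ℝ≥0∞}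
  {α δ : ℝ}

theorem SPA.IsLipschitzLoss.integrable_lipschitz [IsProbabilityMeasure Pξ]
    (hF : IsLipschitzLoss Pξ F L κ) : Integrable L Pξ :=
  ((memLp_two_iff_integrable_sq hF.measurable_const.aestronglyMeasurable).2
    hF.sq_integrable).integrable one_le_two

/-- The ball contains two distinct points, and the Lipschitz inequality between them forces the
sign. -/
theorem SPA.IsLipschitzLoss.ae_nonneg (hF : IsLipschitzLoss Pξ F L κ) (hd : 0 < d) (hδ : 0 < δ)
    (hκ : ENNReal.ofReal δ ≤ κ) : ∀ᵐ ξ ∂Pξ, 0 ≤ L ξ := by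
  have h0 : (0 : Vec d) ∈ linfBall d κ := fun i => by simp
  have h1 : EuclideanSpace.single (⟨0, hd⟩ : Fin d) δ ∈ linfBall d κ :=
    linfBall_mono hκ (closedBall_subset_linfBall d (by simp [abs_of_pos hδ]))
  filter_upwards [hF.lipschitz] with ξ hξ
  have h := (abs_nonneg _).trans (hξ _ h1 _ h0)
  rw [sub_zero, PiLp.norm_single, Real.norm_of_nonneg hδ.le] at h
  exact nonneg_of_mul_nonneg_left h hδ

theorem SPA.IsLipschitzLoss.lipschitzOnWith_expLoss [IsProbabilityMeasure Pξ]
    (hF : IsLipschitzLoss Pξ F L κ) :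
    LipschitzOnWith (∫ ξ, L ξ ∂Pξ).toNNReal (expLoss Pξ F) (linfBall d κ) := by
  refine LipschitzOnWith.of_dist_le_mul fun x hx y hy => ?_
  rw [dist_eq_norm, dist_eq_norm, expLoss, expLoss,
    ← integral_sub (hF.integrable x hx) (hF.integrable y hy)]
  calc _ ≤ ∫ ξ, L ξ * ‖x - y‖ ∂Pξ := by
        refine norm_integral_le_of_norm_le (hF.integrable_lipschitz.mul_const _) ?_
        filter_upwards [hF.lipschitz] with ξ hξ using hξ x hx y hy
    _ = (∫ ξ, L ξ ∂Pξ) * ‖x - y‖ := integral_mul_const _ _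
    _ ≤ _ := by gcongr; exact Real.le_coe_toNNReal _

/-- The zero extension of the loss. -/
noncomputable def zeroExtend (κ : ℝ≥0∞) (F : Vec d → Vec p → ℝ) : Vec d × Vec p → ℝ :=
  (linfBall d κ ×ˢ univ).indicator fun q => F q.1 q.2

theorem zeroExtend_of_mem {x : Vec d} (hx : x ∈ linfBall d κ) (ξ : Vec p) :
    zeroExtend κ F (x, ξ) = F x ξ := indicator_of_mem (by simpa using hx) _

theorem SPA.IsLipschitzLoss.measurable_zeroExtend (hF : IsLipschitzLoss Pξ F L κ) :
    Measurable (zeroExtend κ F) :=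
  Measurable.indicator_fst (isClosed_linfBall d κ).measurableSet hF.measurable

theorem ae_prod_box [SFinite Pξ] (d : ℕ) (α : ℝ) :
    ∀ᵐ z ∂((uniformBox d α).prod Pξ), z.1 ∈ linfBall d (ENNReal.ofReal (α / 2)) :=
  Measure.quasiMeasurePreserving_fst.ae (ae_mem_uniformBox d α)

theorem SPA.IsLipschitzLoss.aestronglyMeasurable_shift [SFinite Pξ]
    (hF : IsLipschitzLoss Pξ F L κ) {x : Vec d}
    (hx : ∀ u ∈ linfBall d (ENNReal.ofReal (α / 2)), x + u ∈ linfBall d κ) :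
    AEStronglyMeasurable (fun z : Vec d × Vec p => F (x + z.1) z.2) ((uniformBox d α).prod Pξ) := by
  have hm : Measurable fun z : Vec d × Vec p => zeroExtend κ F (x + z.1, z.2) :=
    hF.measurable_zeroExtend.comp (by fun_prop)
  refine hm.aestronglyMeasurable.congr ?_
  filter_upwards [ae_prod_box d α] with z hz
  exact zeroExtend_of_mem (hx _ hz) _

theorem SPA.IsLipschitzLoss.integrable_shift [IsProbabilityMeasure Pξ] (hα : 0 < α)
    (hF : IsLipschitzLoss Pξ F L κ) {x : Vec d}
    (hx : ∀ u ∈ linfBall d (ENNReal.ofReal (α / 2)), x + u ∈ linfBall d κ) :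
    Integrable (fun z : Vec d × Vec p => F (x + z.1) z.2) ((uniformBox d α).prod Pξ) := by
  have := uniformBox_isProbabilityMeasure d hα
  have hx0 : x ∈ linfBall d κ := by
    simpa using hx 0 fun i => by simp
  have hb : Integrable (fun z : Vec d × Vec p => |F x z.2| + |L z.2| * (√d * (α / 2)))
      ((uniformBox d α).prod Pξ) :=
    ((hF.integrable x hx0).abs.comp_snd _).add
      ((hF.integrable_lipschitz.abs.comp_snd _).mul_const _)
  refine hb.mono' (hF.aestronglyMeasurable_shift hx) ?_
  filter_upwards [ae_prod_box d α, Measure.quasiMeasurePreserving_fst.ae (ae_norm_le_uniformBox d hα),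
    Measure.quasiMeasurePreserving_snd.ae hF.lipschitz] with z hz hz' hL
  have h1 := hL _ (hx _ hz) _ hx0
  rw [add_sub_cancel_left] at h1
  have h2 : L z.2 * ‖z.1‖ ≤ |L z.2| * (√d * (α / 2)) :=
    mul_le_mul (le_abs_self _) hz' (norm_nonneg _) (abs_nonneg _)
  have h3 := abs_sub_abs_le_abs_sub (F (x + z.1) z.2) (F x z.2)
  rw [Real.norm_eq_abs]
  linarith

theorem SPA.IsLipschitzLoss.integral_shift [IsProbabilityMeasure Pξ] (hα : 0 < α)
    (hF : IsLipschitzLoss Pξ F L κ) {x : Vec d}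
    (hx : ∀ u ∈ linfBall d (ENNReal.ofReal (α / 2)), x + u ∈ linfBall d κ) :
    ∫ z, F (x + z.1) z.2 ∂((uniformBox d α).prod Pξ) = smooth (expLoss Pξ F) α x := by
  have := uniformBox_isProbabilityMeasure d hα
  rw [integral_prod _ (hF.integrable_shift hα hx)]
  rfl

theorem add_mem_linfBall {r : ℝ} (hκ : β + ENNReal.ofReal r + ENNReal.ofReal δ ≤ κ)
    {w x u : Vec d} (hw : w ∈ linfBall d β) (hx : ‖x - w‖ ≤ δ)
    (hu : u ∈ linfBall d (ENNReal.ofReal r)) : x + u ∈ linfBall d κ := by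
  have : x + u = w + u + (x - w) := by abel
  rw [this]
  exact linfBall_mono hκ (linfBall_add (linfBall_add hw hu) (closedBall_subset_linfBall d hx))

/-- The margin `δ` gives agreement on a neighbourhood and not only at `w`, so derivatives agree as
well. -/
theorem smooth_eventuallyEq {f f' : Vec d → ℝ} (hδ : 0 < δ)
    (hκ : β + ENNReal.ofReal (α / 2) + ENNReal.ofReal δ ≤ κ) (hff' : EqOn f f' (linfBall d κ))
    {w : Vec d} (hw : w ∈ linfBall d β) : smooth f α =ᶠ[𝓝 w] smooth f' α := by
  filter_upwards [Metric.closedBall_mem_nhds w hδ] with x hx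
  rw [Metric.mem_closedBall, dist_eq_norm] at hx
  refine integral_congr_ae ?_
  filter_upwards [ae_mem_uniformBox d α] with u hu
  exact hff' (add_mem_linfBall hκ hw hx hu)

/-- The modified point is again `w` plus an element of the cube. -/
theorem setCoord_mem {a : ℝ} (hα : 0 < α) (ha : |a| ≤ α / 2) (hδ : 0 < δ)
    (hκ : β + ENNReal.ofReal (α / 2) + ENNReal.ofReal δ ≤ κ)
    {w u : Vec d} (hw : w ∈ linfBall d β) (hu : u ∈ linfBall d (ENNReal.ofReal (α / 2)))
    (i : Fin d) : setCoord (w + u) i (w i + a) ∈ linfBall d κ := by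
  have h := setCoord_add (w := w) (u := u) i 0 a
  simp only [zero_smul, add_zero] at h
  rw [← h]
  refine add_mem_linfBall hκ hw (by simpa using hδ.le) ?_
  rw [linfBall_ofReal d (by positivity)] at hu ⊢
  intro j
  by_cases hj : j = i
  · subst hj; simpa [setCoord] using ha
  · simpa [setCoord, Function.update_of_ne hj] using hu j

/-- The gradient estimates, set to zero outside of the region where they are needed. -/
noncomputable def gradEstimateOn (β : ℝ≥0∞) (m : Setting) (F : Vec d → Vec p → ℝ)
    (gradF : Vec d → Vec p → Vec d) (α : ℝ) (w : Vec d) (z : Vec d × Vec p) : Vec d :=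
  {q : Vec d × (Vec d × Vec p) | q.1 ∈ linfBall d β ∧
    q.2.1 ∈ linfBall d (ENNReal.ofReal (α / 2))}.indicator
      (fun q => gradEstimate m F gradF α q.1 q.2.1 q.2.2) (w, z)

variable {m : Setting} {gradF : Vec d → Vec p → Vec d}

theorem gradEstimateOn_of_mem {w : Vec d} {z : Vec d × Vec p} (hw : w ∈ linfBall d β)
    (hz : z.1 ∈ linfBall d (ENNReal.ofReal (α / 2))) :
    gradEstimateOn β m F gradF α w z = gradEstimate m F gradF α w z.1 z.2 :=
  indicator_of_mem (s := {q : Vec d × (Vec d × Vec p) | q.1 ∈ linfBall d β ∧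
    q.2.1 ∈ linfBall d (ENNReal.ofReal (α / 2))}) (a := (w, z)) ⟨hw, hz⟩ _

theorem measurable_gradEstimateOn (hα : 0 < α) (hδ : 0 < δ)
    (hκ : β + ENNReal.ofReal (α / 2) + ENNReal.ofReal δ ≤ κ) (hF : IsLipschitzLoss Pξ F L κ)
    (hgrad : m = Setting.firstOrder → IsGradVersion Pξ F β α gradF) :
    Measurable fun q : Vec d × (Vec d × Vec p) => gradEstimateOn β m F gradF α q.1 q.2 := by
  have hs : MeasurableSet {q : Vec d × (Vec d × Vec p) | q.1 ∈ linfBall d β ∧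
      q.2.1 ∈ linfBall d (ENNReal.ofReal (α / 2))} :=
    (measurable_fst (isClosed_linfBall d _).measurableSet).inter
      ((measurable_fst.comp measurable_snd) (isClosed_linfBall d _).measurableSet)
  have key : ∀ h : Vec d × (Vec d × Vec p) → Vec d, Measurable h →
      (∀ q : Vec d × (Vec d × Vec p), q.1 ∈ linfBall d β →
        q.2.1 ∈ linfBall d (ENNReal.ofReal (α / 2)) →
        gradEstimate m F gradF α q.1 q.2.1 q.2.2 = h q) →
      Measurable fun q : Vec d × (Vec d × Vec p) => gradEstimateOn β m F gradF α q.1 q.2 := by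
    intro h hm heq
    have : (fun q : Vec d × (Vec d × Vec p) => gradEstimateOn β m F gradF α q.1 q.2) =
        {q : Vec d × (Vec d × Vec p) | q.1 ∈ linfBall d β ∧
          q.2.1 ∈ linfBall d (ENNReal.ofReal (α / 2))}.indicator h := by
      funext q
      exact congrFun (indicator_congr fun q hq => heq q hq.1 hq.2) q
    rw [this]
    exact hm.indicator hs
  cases m with
  | zerothOrder =>
    have hZ := hF.measurable_zeroExtend
    have hpt : ∀ (i : Fin d) (a : ℝ), Measurable fun q : Vec d × (Vec d × Vec p) =>
        zeroExtend κ F (setCoord (q.1 + q.2.1) i (q.1 i + a), q.2.2) := fun i a => by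
      refine hZ.comp (Measurable.prodMk ?_ (by fun_prop))
      exact (measurable_setCoord i).comp
        (f := fun q : Vec d × (Vec d × Vec p) => (q.1 + q.2.1, q.1 i + a)) (by fun_prop)
    refine key (fun q => α⁻¹ • WithLp.toLp 2 fun i =>
      zeroExtend κ F (setCoord (q.1 + q.2.1) i (q.1 i + α / 2), q.2.2) -
        zeroExtend κ F (setCoord (q.1 + q.2.1) i (q.1 i + -(α / 2)), q.2.2)) ?_ ?_
    · have hv : Measurable fun q : Vec d × (Vec d × Vec p) => (WithLp.toLp 2 fun i =>
          zeroExtend κ F (setCoord (q.1 + q.2.1) i (q.1 i + α / 2), q.2.2) -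
            zeroExtend κ F (setCoord (q.1 + q.2.1) i (q.1 i + -(α / 2)), q.2.2) : Vec d) :=
        (WithLp.measurable_toLp 2 _).comp
          (measurable_pi_lambda _ fun i => (hpt i _).sub (hpt i _))
      exact hv.fun_const_smul α⁻¹
    · intro q hw hu
      have hα' : |α / 2| ≤ α / 2 := (abs_of_pos (by positivity)).le
      simp only [gradEstimate, finDiff]
      congr 2
      funext i
      rw [zeroExtend_of_mem (setCoord_mem hα hα' hδ hκ hw hu i),
        zeroExtend_of_mem (setCoord_mem hα (by rwa [abs_neg]) hδ hκ hw hu i), sub_eq_add_neg (q.1 i)]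
  | firstOrder =>
    have hm := Measurable.indicator_fst (isClosed_linfBall d _).measurableSet (hgrad rfl).measurable
    refine key _ (hm.comp (f := fun q : Vec d × (Vec d × Vec p) => (q.1 + q.2.1, q.2.2))
      (by fun_prop)) ?_
    intro q hw hu
    rw [Function.comp_apply, indicator_of_mem]
    · rfl
    · exact ⟨linfBall_add hw hu, mem_univ _⟩

/-- The two points of a finite difference are `α` apart, so each of the `d` components is at most `L
ξ` in absolute value; a true gradient is bounded as a whole by the local Lipschitz constant. This is
the origin of `υ`. -/
theorem ae_norm_gradEstimate_le [IsProbabilityMeasure Pξ] (hd : 0 < d) (hα : 0 < α) (hδ : 0 < δ)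
    (hκ : β + ENNReal.ofReal (α / 2) + ENNReal.ofReal δ ≤ κ) (hF : IsLipschitzLoss Pξ F L κ)
    (hgrad : m = Setting.firstOrder → IsGradVersion Pξ F β α gradF) {w : Vec d}
    (hw : w ∈ linfBall d β) :
    ∀ᵐ z ∂((uniformBox d α).prod Pξ),
      ‖gradEstimateOn β m F gradF α w z‖ ^ 2 ≤ m.upsilon d * L z.2 ^ 2 := by
  have := uniformBox_isProbabilityMeasure d hα
  cases m with
  | zerothOrder =>
    filter_upwards [ae_prod_box d α, Measure.quasiMeasurePreserving_snd.ae hF.lipschitz] with z hz hL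
    have hα' : |α / 2| ≤ α / 2 := (abs_of_pos (by positivity)).le
    rw [gradEstimateOn_of_mem hw hz, EuclideanSpace.norm_sq_eq]
    simp only [gradEstimate, finDiff, Setting.upsilon]
    calc _ ≤ ∑ _i : Fin d, L z.2 ^ 2 := by
          refine Finset.sum_le_sum fun i _ => ?_
          refine pow_le_pow_left₀ (norm_nonneg _) ?_ 2
          have h := hL _ (setCoord_mem hα hα' hδ hκ hw hz i) _
            (setCoord_mem (a := -(α / 2)) hα (by rwa [abs_neg]) hδ hκ hw hz i)
          have hdiff : setCoord (w + z.1) i (w i + α / 2) - setCoord (w + z.1) i (w i + -(α / 2)) =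
              EuclideanSpace.single i α := by
            ext j
            by_cases hj : j = i
            · subst hj; simp [setCoord]
            · simp [setCoord, hj]
          rw [hdiff, PiLp.norm_single, Real.norm_of_nonneg hα.le, ← sub_eq_add_neg] at h
          rw [PiLp.smul_apply, norm_smul, norm_inv, Real.norm_of_nonneg hα.le,
            inv_mul_le_iff₀ hα, mul_comm, Real.norm_eq_abs]
          exact h
      _ = d * L z.2 ^ 2 := by simp
  | firstOrder =>
    have hδκ : ENNReal.ofReal δ ≤ κ := le_add_self.trans hκ
    filter_upwards [ae_prod_box d α, Measure.quasiMeasurePreserving_snd.ae hF.lipschitz,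
      (hgrad rfl).hasGradientAt w hw,
      Measure.quasiMeasurePreserving_snd.ae (hF.ae_nonneg hd hδ hδκ)] with z hz hL hg hL0
    rw [gradEstimateOn_of_mem hw hz]
    simp only [gradEstimate, Setting.upsilon, one_mul]
    refine pow_le_pow_left₀ (norm_nonneg _) ?_ 2
    have h := (hasGradientAt_iff_hasFDerivAt.1 hg).le_of_lip' hL0 ?_
    · simpa using h
    · filter_upwards [Metric.closedBall_mem_nhds (w + z.1) hδ] with x hx
      rw [Metric.mem_closedBall, dist_eq_norm] at hx
      refine hL x ?_ _ (add_mem_linfBall hκ hw (by simpa using hδ.le) hz)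
      have : x = (x - z.1) + z.1 := by abel
      rw [this]
      exact add_mem_linfBall hκ hw (by rwa [sub_sub, add_comm z.1]) hz

theorem memLp_gradEstimateOn [IsProbabilityMeasure Pξ] (hd : 0 < d) (hα : 0 < α) (hδ : 0 < δ)
    (hκ : β + ENNReal.ofReal (α / 2) + ENNReal.ofReal δ ≤ κ) (hF : IsLipschitzLoss Pξ F L κ)
    (hgrad : m = Setting.firstOrder → IsGradVersion Pξ F β α gradF) {w : Vec d}
    (hw : w ∈ linfBall d β) :
    MemLp (gradEstimateOn β m F gradF α w) 2 ((uniformBox d α).prod Pξ) ∧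
    ∫ z, ‖gradEstimateOn β m F gradF α w z‖ ^ 2 ∂((uniformBox d α).prod Pξ) ≤
      m.upsilon d * ∫ ξ, L ξ ^ 2 ∂Pξ := by
  have := uniformBox_isProbabilityMeasure d hα
  have hm : Measurable (gradEstimateOn β m F gradF α w) :=
    (measurable_gradEstimateOn hα hδ hκ hF hgrad).comp (measurable_prodMk_left (x := w))
  have hb := ae_norm_gradEstimate_le hd hα hδ hκ hF hgrad hw
  have hi : Integrable (fun z : Vec d × Vec p => m.upsilon d * L z.2 ^ 2)
      ((uniformBox d α).prod Pξ) := (hF.sq_integrable.comp_snd _).const_mul _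
  have hi' : Integrable (fun z => ‖gradEstimateOn β m F gradF α w z‖ ^ 2)
      ((uniformBox d α).prod Pξ) := by
    refine hi.mono' (hm.norm.pow_const 2).aestronglyMeasurable ?_
    filter_upwards [hb] with z hz
    rwa [Real.norm_of_nonneg (sq_nonneg _)]
  refine ⟨(memLp_two_iff_integrable_sq_norm hm.aestronglyMeasurable).2 hi', ?_⟩
  refine (integral_mono_ae hi' hi hb).trans_eq ?_
  rw [integral_const_mul, integral_fun_snd (μ := uniformBox d α) (fun ξ => L ξ ^ 2)]
  simp

/-- In the zeroth-order setting, integrating over `ξ` first turns `F` into `f` and leaves the finite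
difference formula. In the first-order setting, `F (x + u) ξ` is differentiated in `x` under the
joint integral over `(u, ξ)`. -/
theorem integral_gradEstimateOn [IsProbabilityMeasure Pξ] (hd : 0 < d) (hα : 0 < α) (hδ : 0 < δ)
    (hκ : β + ENNReal.ofReal (α / 2) + ENNReal.ofReal δ ≤ κ) (hF : IsLipschitzLoss Pξ F L κ)
    (hgrad : m = Setting.firstOrder → IsGradVersion Pξ F β α gradF) {w : Vec d}
    (hw : w ∈ linfBall d β) {f : Vec d → ℝ} {C : NNReal} (hf : LipschitzWith C f)
    (hfF : EqOn (expLoss Pξ F) f (linfBall d κ)) (c : Fin d) :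
    ∫ z, gradEstimateOn β m F gradF α w z c ∂((uniformBox d α).prod Pξ) =
      (∇ (smooth f α) w) c := by
  have := uniformBox_isProbabilityMeasure d hα
  have hLp := (memLp_gradEstimateOn hd hα hδ hκ hF hgrad hw).1
  cases m with
  | zerothOrder =>
    have hα' : |α / 2| ≤ α / 2 := (abs_of_pos (by positivity)).le
    have hint := (hLp.continuousLinearMap_comp (EuclideanSpace.proj (𝕜 := ℝ) c)).integrable
      one_le_two
    simp only [PiLp.proj_apply] at hint
    rw [integral_prod _ hint, gradient_smooth_apply hf hα, ← integral_const_mul]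
    refine integral_congr_ae ?_
    filter_upwards [ae_mem_uniformBox d α] with u hu
    have h1 := setCoord_mem hα hα' hδ hκ hw hu c
    have h2 := setCoord_mem (a := -(α / 2)) hα (by rwa [abs_neg]) hδ hκ hw hu c
    rw [← sub_eq_add_neg] at h2
    have heq : ∀ ξ, gradEstimateOn β .zerothOrder F gradF α w (u, ξ) c =
        α⁻¹ * (F (setCoord (w + u) c (w c + α / 2)) ξ -
          F (setCoord (w + u) c (w c - α / 2)) ξ) := fun ξ => by
      rw [gradEstimateOn_of_mem hw hu]
      rfl
    simp only [heq]
    rw [integral_const_mul, integral_sub (hF.integrable _ h1) (hF.integrable _ h2), ← hfF h1,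
      ← hfF h2]
    rfl
  | firstOrder =>
    let D := InnerProductSpace.toDual ℝ (Vec d)
    have hg := (hgrad rfl).hasGradientAt w hw
    have hnear : ∀ x ∈ Metric.closedBall w δ, ∀ u ∈ linfBall d (ENNReal.ofReal (α / 2)),
        x + u ∈ linfBall d κ := fun x hx u hu =>
      add_mem_linfBall hκ hw (by rwa [Metric.mem_closedBall, dist_eq_norm] at hx) hu
    have hnhds := Metric.closedBall_mem_nhds w hδ
    have hpar := (hasFDerivAt_integral_of_dominated_loc_of_lip
      (μ := (uniformBox d α).prod Pξ) (x₀ := w)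
      (F := fun x (z : Vec d × Vec p) => F (x + z.1) z.2)
      (F' := fun z => D (gradEstimateOn β .firstOrder F gradF α w z))
      (bound := fun z => L z.2) hnhds ?_ (hF.integrable_shift hα (hnear w (mem_of_mem_nhds hnhds)))
      ?_ ?_ (hF.integrable_lipschitz.comp_snd _) ?_).2
    · have h1 : HasFDerivAt (smooth f α)
          (∫ z, D (gradEstimateOn β .firstOrder F gradF α w z) ∂((uniformBox d α).prod Pξ)) w := by
        refine hpar.congr_of_eventuallyEq ?_
        filter_upwards [hnhds, smooth_eventuallyEq hδ hκ hfF hw] with x hx hx'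
        rw [hF.integral_shift hα (hnear x hx), hx']
      have h2 : ∇ (smooth f α) w =
          ∫ z, gradEstimateOn β .firstOrder F gradF α w z ∂((uniformBox d α).prod Pξ) := by
        rw [gradient, h1.fderiv]
        have := D.toContinuousLinearEquiv.integral_comp_comm (μ := (uniformBox d α).prod Pξ)
          (gradEstimateOn β .firstOrder F gradF α w)
        rw [LinearIsometryEquiv.symm_apply_eq]
        exact this
      rw [h2]
      exact (EuclideanSpace.proj (𝕜 := ℝ) c).integral_comp_comm (hLp.integrable one_le_two)
    · filter_upwards [hnhds] with x hx using hF.aestronglyMeasurable_shift (hnear x hx)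
    · exact D.continuous.comp_aestronglyMeasurable hLp.aestronglyMeasurable
    · filter_upwards [ae_prod_box d α, Measure.quasiMeasurePreserving_snd.ae hF.lipschitz] with z hz hL
      refine LipschitzOnWith.of_dist_le_mul fun x hx y hy => ?_
      have h := hL _ (hnear x hx _ hz) _ (hnear y hy _ hz)
      rw [add_sub_add_right_eq_sub] at h
      rw [dist_eq_norm, dist_eq_norm]
      refine h.trans ?_
      gcongr
      exact le_abs_self _
    · filter_upwards [ae_prod_box d α, hg] with z hz hgz
      have h := HasFDerivAt.comp (f := fun x : Vec d => x + z.1) w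
        (hasGradientAt_iff_hasFDerivAt.1 hgz) ((hasFDerivAt_id w).add_const z.1)
      rw [gradEstimateOn_of_mem hw hz]
      simpa [Function.comp_def, D, gradEstimate] using h

end Loss

/-! ### Convergence and complexity -/

theorem C₁_pos {ρ : ℝ} (hρ : 1 < ρ) : 0 < C₁ ρ := by
  have : 0 < ρ - 1 := by linarith
  unfold C₁; positivity

theorem C₂_pos {ρ : ℝ} (hρ : 1 < ρ) : 0 < C₂ ρ := by
  have : 0 < ρ - 1 := by linarith
  unfold C₂; positivity

theorem upsilon_pos {d : ℕ} (hd : 0 < d) (m : Setting) : 0 < m.upsilon d := by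
  cases m
  · simpa [Setting.upsilon] using hd
  · simp [Setting.upsilon]

/-- The step size has the form `2 / (3 ρ L)` of the one-step estimate, with `L` the Lipschitz
constant of the smoothed gradient. -/
theorem stepSize_eq {d : ℕ} (hd : 0 < d) {ρ L₀ α : ℝ} (hα : 0 < α) (hL₀ : 0 < L₀) :
    stepSize d ρ L₀ α = 2 / (3 * ρ * (2 * √d * L₀ / α)) := by
  have : (0 : ℝ) < √d := Real.sqrt_pos.2 (by exact_mod_cast hd)
  unfold stepSize
  field_simp

theorem exists_margin {β κ : ℝ≥0∞} {r : ℝ} (h : β + ENNReal.ofReal r < κ ∨ κ = ⊤) :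
    ∃ δ : ℝ, 0 < δ ∧ β + ENNReal.ofReal r + ENNReal.ofReal δ ≤ κ := by
  rcases h with h | rfl
  · obtain ⟨δ, hδ, hlt⟩ := ENNReal.lt_iff_exists_add_pos_lt.1 h
    exact ⟨δ, by exact_mod_cast hδ, by simpa using hlt.le⟩
  · exact ⟨1, one_pos, le_top⟩

section Convergence

variable {d p : ℕ} {Pξ : Measure (Vec p)} [IsProbabilityMeasure Pξ] {F : Vec d → Vec p → ℝ}
  {L : Vec p → ℝ} {κ β : ℝ≥0∞} {α δ : ℝ} {m : Setting} {gradF : Vec d → Vec p → Vec d}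

theorem sq_integral_le_integral_sq (hF : IsLipschitzLoss Pξ F L κ) :
    (∫ ξ, L ξ ∂Pξ) ^ 2 ≤ ∫ ξ, L ξ ^ 2 ∂Pξ := by
  have h := variance_nonneg L Pξ
  rw [variance_eq_sub ((memLp_two_iff_integrable_sq
    hF.measurable_const.aestronglyMeasurable).2 hF.sq_integrable)] at h
  simp only [Pi.pow_apply] at h
  linarith

/-- The common core of both criteria. The hypotheses `hK` and `hM` say that the optimisation term
and the variance term are each at most `ε² / 2`. -/
theorem run_point_spec (hd : 0 < d) (hα : 0 < α) (hδ : 0 < δ)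
    (hκ : β + ENNReal.ofReal (α / 2) + ENNReal.ofReal δ ≤ κ) (hF : IsLipschitzLoss Pξ F L κ)
    (hgrad : m = Setting.firstOrder → IsGradVersion Pξ F β α gradF)
    {L₀ Q : ℝ} (hQ : Q = ∫ ξ, L ξ ^ 2 ∂Pξ) (hL₀ : 0 < L₀) (hQ0 : 0 < Q)
    {f : Vec d → ℝ} (hf : LipschitzWith L₀.toNNReal f) (hfF : EqOn (expLoss Pξ F) f (linfBall d κ))
    {S : Set (Vec d)} (hS : IsClosed S) {w₁ : Vec d} (hw₁ : w₁ ∈ S ∩ linfBall d β)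
    {ρ Δ ε : ℝ} (hρ : 1 < ρ) (hΔ0 : 0 < Δ) (hε : 0 < ε)
    (hΔ : ∀ w ∈ S ∩ linfBall d β,
      smooth (expLoss Pξ F) α w₁ - smooth (expLoss Pξ F) α w ≤ Δ)
    {proj : ℕ → Vec d → Vec d} (hproj : ∀ j, IsProjSelection (S ∩ linfBall d β) (proj j))
    {K M : ℕ} (hK : C₁ ρ * (2 * √d * L₀ / α * Δ) ≤ K * (ε ^ 2 / 2))
    (hM : C₂ ρ * (m.upsilon d * Q) ≤ M * (ε ^ 2 / 2)) :
    (∀ seed : Seed d p K M,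
      (run m F gradF proj α (stepSize d ρ L₀ α) w₁ seed).point ∈ S ∩ linfBall d β) ∧
    AEMeasurable (fun seed : Seed d p K M =>
      (run m F gradF proj α (stepSize d ρ L₀ α) w₁ seed).point) (seedLaw d α Pξ K M) ∧
    ∫⁻ seed : Seed d p K M, Metric.infEDist 0
      ({∇ (smooth f α) (run m F gradF proj α (stepSize d ρ L₀ α) w₁ seed).point} +
        normalCone (S ∩ linfBall d β) (run m F gradF proj α (stepSize d ρ L₀ α) w₁ seed).point)
      ∂(seedLaw d α Pξ K M) ≤ ENNReal.ofReal ε := by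
  have := uniformBox_isProbabilityMeasure d hα
  have hd' : (0 : ℝ) < √d := Real.sqrt_pos.2 (by exact_mod_cast hd)
  have hLip : 0 < 2 * √d * L₀ / α := by positivity
  have hυ := upsilon_pos hd m
  have hK0 : 0 < K := by
    have h1 : 0 < C₁ ρ * (2 * √d * L₀ / α * Δ) := mul_pos (C₁_pos hρ) (by positivity)
    have h2 := h1.trans_le hK
    exact_mod_cast pos_of_mul_pos_left h2 (by positivity)
  have hM0 : 0 < M := by
    have h1 : 0 < C₂ ρ * (m.upsilon d * Q) := mul_pos (C₂_pos hρ) (by positivity)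
    have h2 := h1.trans_le hM
    exact_mod_cast pos_of_mul_pos_left h2 (by positivity)
  have hprojT : ∀ j x, proj j x ∈ S ∩ linfBall d β := fun j x => ((hproj j).2 x).1
  have hrun : ∀ seed : Seed d p K M, (run m F gradF proj α (stepSize d ρ L₀ α) w₁ seed).point =
      iterates proj (fun w z => gradEstimate m F gradF α w z.1 z.2)
        (2 / (3 * ρ * (2 * √d * L₀ / α))) w₁ seed.2 (seed.1 - 1) := fun seed => by
    rw [run_eq, stepSize_eq hd hα hL₀]
    exact iterates_min _ _ _ _ _ _
  -- Almost surely all samples lie in the cube, and the iterates always lie in the ball of radius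
  -- `β`, so the cut-off estimates generate the same trajectory.
  have hae : ∀ᵐ seed ∂(seedLaw d α Pξ K M),
      (run m F gradF proj α (stepSize d ρ L₀ α) w₁ seed).point =
      iterates proj (gradEstimateOn β m F gradF α)
        (2 / (3 * ρ * (2 * √d * L₀ / α))) w₁ seed.2 (seed.1 - 1) := by
    have h1 : ∀ᵐ b : Fin K → Fin M → Vec d × Vec p ∂(Measure.pi fun _ : Fin K =>
        Measure.pi fun _ : Fin M => (uniformBox d α).prod Pξ),
        ∀ k i, (b k i).1 ∈ linfBall d (ENNReal.ofReal (α / 2)) := by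
      rw [ae_all_iff]
      intro k
      rw [ae_all_iff]
      intro i
      have h2 : ∀ᵐ s : Fin M → Vec d × Vec p ∂(Measure.pi fun _ : Fin M => (uniformBox d α).prod Pξ),
          (s i).1 ∈ linfBall d (ENNReal.ofReal (α / 2)) :=
        (measurePreserving_eval (fun _ : Fin M => (uniformBox d α).prod Pξ) i).quasiMeasurePreserving.ae
          (ae_prod_box d α)
      exact (measurePreserving_eval (fun _ : Fin K => Measure.pi fun _ : Fin M =>
        (uniformBox d α).prod Pξ) k).quasiMeasurePreserving.ae h2
    filter_upwards [Measure.quasiMeasurePreserving_snd.ae h1] with seed hseed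
    rw [hrun]
    exact iterates_congr hw₁ hprojT (fun w hw k i => (gradEstimateOn_of_mem hw.2 (hseed k i)).symm) _
  have hφ : ∀ x, HasGradientAt (smooth f α) (∇ (smooth f α) x) x := fun x =>
    (hasFDerivAt_smooth hf hα x).2.differentiableAt.hasGradientAt
  have hG : ∀ x y, ‖∇ (smooth f α) x - ∇ (smooth f α) y‖ ≤ 2 * √d * L₀ / α * ‖x - y‖ := fun x y => by
    have := norm_gradient_smooth_sub_le hf hα x y
    rwa [Real.coe_toNNReal _ hL₀.le] at this
  have hsm : ∀ w ∈ S ∩ linfBall d β, smooth (expLoss Pξ F) α w = smooth f α w := fun w hw =>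
    (smooth_eventuallyEq hδ hκ hfF hw.2).eq_of_nhds
  obtain ⟨hWm, hint⟩ := lintegral_iterates_infEDist_le (p := p) hα Pξ hM0 hK0
    (hS.inter (isClosed_linfBall d β)) (g := gradEstimateOn β m F gradF α) hLip hρ hφ hG hw₁ hproj
    (fun w hw => by rw [← hsm w hw, ← hsm w₁ hw₁]; exact hΔ w hw) hΔ0.le
    (measurable_gradEstimateOn hα hδ hκ hF hgrad)
    (fun w hw => (memLp_gradEstimateOn hd hα hδ hκ hF hgrad hw.2).1)
    (fun w hw c => integral_gradEstimateOn hd hα hδ hκ hF hgrad hw.2 hf hfF c)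
    (fun w hw => by
      rw [hQ]; exact (memLp_gradEstimateOn hd hα hδ hκ hF hgrad hw.2).2) (by positivity) hε hK hM
  refine ⟨fun seed => ?_, hWm.aemeasurable.congr ?_, ?_⟩
  · rw [hrun]; exact iterates_mem hw₁ hprojT _ _
  · filter_upwards [hae] with seed h using h.symm
  · refine le_trans (lintegral_congr_ae ?_).le hint
    filter_upwards [hae] with seed h
    rw [h]

end Convergence

/-- The `+ 1` from rounding up is absorbed because `ε * ε' ^ 2 ≤ b ^ 3`; the complexity bounds need
bounded accuracies for this reason. -/
theorem ceil_le_of_le {A b ε ε' : ℝ} (hA : 0 ≤ A) (hε : ε ∈ Ioc 0 b) (hε' : ε' ∈ Ioc 0 b) :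
    ((⌈A / (ε * ε' ^ 2)⌉₊ : ℕ) : ℝ) ≤ (A + b ^ 3) * (ε⁻¹ * ε'⁻¹ ^ 2) := by
  have h0 := hε.1
  have h0' := hε'.1
  refine (Nat.ceil_lt_add_one (by positivity)).le.trans ?_
  have h1 : ε * ε' ^ 2 ≤ b ^ 3 := by
    calc ε * ε' ^ 2 ≤ b * b ^ 2 := by gcongr; exacts [h0.le.trans hε.2, hε.2, hε'.2]
      _ = b ^ 3 := by ring
  have h2 : ε⁻¹ * ε'⁻¹ ^ 2 = (ε * ε' ^ 2)⁻¹ := by rw [mul_inv, inv_pow]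
  rw [h2, add_mul, ← div_eq_mul_inv, ← div_eq_mul_inv]
  gcongr
  rwa [one_le_div (by positivity)]

theorem ceil_le_of_le_sq {B b ε : ℝ} (hB : 0 ≤ B) (hε : ε ∈ Ioc 0 b) :
    ((⌈B / ε ^ 2⌉₊ : ℕ) : ℝ) ≤ (B + b ^ 2) * ε⁻¹ ^ 2 := by
  have h0 := hε.1
  refine (Nat.ceil_lt_add_one (by positivity)).le.trans ?_
  have h1 : ε ^ 2 ≤ b ^ 2 := pow_le_pow_left₀ h0.le hε.2 2
  rw [inv_pow, add_mul, ← div_eq_mul_inv, ← div_eq_mul_inv]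
  gcongr
  rwa [one_le_div (by positivity)]

/-- The complexity of the algorithm in terms of the accuracies. -/
theorem exists_cost_bound {A B b : ℝ} (hA : 0 ≤ A) (hB : 0 ≤ B) (hb : 0 < b) :
    ∃ c : ℝ, ∀ ε ∈ Ioc 0 b, ∀ ε' ∈ Ioc 0 b, ∀ (K M : ℕ), K = ⌈A / (ε * ε' ^ 2)⌉₊ →
      M = ⌈B / ε' ^ 2⌉₊ → ∀ {d p : ℕ} (m : Setting) (F : Vec d → Vec p → ℝ)
      (gradF : Vec d → Vec p → Vec d) (proj : ℕ → Vec d → Vec d) (α η : ℝ) (w₁ : Vec d)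
      (seed : Seed d p K M),
      ((run m F gradF proj α η w₁ seed).gradCalls : ℝ) ≤ c * (ε⁻¹ * ε'⁻¹ ^ 4) ∧
      ((run m F gradF proj α η w₁ seed).projections : ℝ) ≤ c * (ε⁻¹ * ε'⁻¹ ^ 2) := by
  refine ⟨(A + b ^ 3) * (B + b ^ 2) + (A + b ^ 3), fun ε hε ε' hε' K M hK hM d p m F gradF proj α η
    w₁ seed => ?_⟩
  have h0 := hε.1
  have h0' := hε'.1
  have hK' : (K : ℝ) ≤ (A + b ^ 3) * (ε⁻¹ * ε'⁻¹ ^ 2) := hK ▸ ceil_le_of_le hA hε hε'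
  have hM' : (M : ℝ) ≤ (B + b ^ 2) * ε'⁻¹ ^ 2 := hM ▸ ceil_le_of_le_sq hB hε'
  rw [run_eq]
  constructor
  · calc ((min (seed.1 - 1) K * M : ℕ) : ℝ) ≤ K * M := by
          exact_mod_cast Nat.mul_le_mul_right M (min_le_right _ _)
      _ ≤ ((A + b ^ 3) * (ε⁻¹ * ε'⁻¹ ^ 2)) * ((B + b ^ 2) * ε'⁻¹ ^ 2) := by gcongr
      _ = (A + b ^ 3) * (B + b ^ 2) * (ε⁻¹ * ε'⁻¹ ^ 4) := by ring
      _ ≤ _ := by gcongr; exact le_add_of_nonneg_right (add_nonneg hA (pow_nonneg hb.le 3))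
  · calc ((min (seed.1 - 1) K : ℕ) : ℝ) ≤ K := Nat.cast_le.2 (min_le_right _ _)
      _ ≤ (A + b ^ 3) * (ε⁻¹ * ε'⁻¹ ^ 2) := hK'
      _ ≤ _ := mul_le_mul_of_nonneg_right (le_add_of_nonneg_left (by positivity)) (by positivity)

theorem corollary2 {d p : ℕ} (hd : 0 < d)
    -- the stochastic loss and its Lipschitz constants
    (Pξ : Measure (Vec p)) [IsProbabilityMeasure Pξ]
    (F : Vec d → Vec p → ℝ) (L : Vec p → ℝ) (κ : ℝ≥0∞) (hF : IsLipschitzLoss Pξ F L κ)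
    (L₀ Q : ℝ) (hL₀ : L₀ = ∫ ξ, L ξ ∂Pξ) (hQ : Q = ∫ ξ, L ξ ^ 2 ∂Pξ) (hL₀_pos : 0 < L₀)
    -- the constraint set and the starting point
    (S : Set (Vec d)) (hS : IsClosed S) (β : ℝ≥0∞) (hβ : 0 < β)
    (w₁ : Vec d) (hw₁ : w₁ ∈ S ∩ linfBall d β)
    -- the setting of the algorithm and the remaining parameters
    (m : Setting) (ρ : ℝ) (hρ : 1 < ρ) (Δ : ℝ) (hΔ : 0 < Δ) :
    -- expected `(ε₁, ε₂)`-stationarity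
    (∀ ε₁ ε₂ : ℝ, 0 < ε₁ → 0 < ε₂ → ∀ (α : ℝ) (K M : ℕ),
      α = ε₁ / (L₀ * √(d / 12)) →
      K = ⌈C₁ ρ * √(4 / 3) * (d * L₀ ^ 2 * Δ / (ε₁ * ε₂ ^ 2))⌉₊ →
      M = ⌈C₂ ρ * (2 * m.upsilon d * Q / ε₂ ^ 2)⌉₊ →
      (β + ENNReal.ofReal (α / 2) < κ ∨ κ = ⊤) →
      (∀ w ∈ S ∩ linfBall d β,
        smooth (expLoss Pξ F) α w₁ - smooth (expLoss Pξ F) α w ≤ Δ) →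
      ∀ gradF : Vec d → Vec p → Vec d,
      (m = Setting.firstOrder → IsGradVersion Pξ F β α gradF) →
      ∀ proj : ℕ → Vec d → Vec d, (∀ j, IsProjSelection (S ∩ linfBall d β) (proj j)) →
      IsExpectedStationary₁₂ (expLoss Pξ F) α S β ε₁ ε₂ (seedLaw d α Pξ K M)
        (fun seed => (run m F gradF proj α (stepSize d ρ L₀ α) w₁ seed).point)) ∧
    -- its cost
    (∀ b : ℝ, 0 < b → ∃ c : ℝ, ∀ ε₁ ∈ Set.Ioc 0 b, ∀ ε₂ ∈ Set.Ioc 0 b, ∀ (α : ℝ) (K M : ℕ),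
      α = ε₁ / (L₀ * √(d / 12)) →
      K = ⌈C₁ ρ * √(4 / 3) * (d * L₀ ^ 2 * Δ / (ε₁ * ε₂ ^ 2))⌉₊ →
      M = ⌈C₂ ρ * (2 * m.upsilon d * Q / ε₂ ^ 2)⌉₊ →
      ∀ (gradF : Vec d → Vec p → Vec d) (proj : ℕ → Vec d → Vec d) (seed : Seed d p K M),
      ((run m F gradF proj α (stepSize d ρ L₀ α) w₁ seed).gradCalls : ℝ)
        ≤ c * (ε₁⁻¹ * ε₂⁻¹ ^ 4) ∧
      ((run m F gradF proj α (stepSize d ρ L₀ α) w₁ seed).projections : ℝ)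
        ≤ c * (ε₁⁻¹ * ε₂⁻¹ ^ 2)) ∧
    -- expected `(ε₃, ε₄)`-stationarity
    (∀ ε₃ ε₄ : ℝ, 0 < ε₃ → 0 < ε₄ → ∀ (α : ℝ) (K M : ℕ),
      α = 2 * ε₃ / √d →
      K = ⌈C₁ ρ * (2 * d * L₀ * Δ / (ε₃ * ε₄ ^ 2))⌉₊ →
      M = ⌈C₂ ρ * (2 * m.upsilon d * Q / ε₄ ^ 2)⌉₊ →
      (β + ENNReal.ofReal ε₃ < κ ∨ κ = ⊤) →
      (∀ w ∈ S ∩ linfBall d β,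
        smooth (expLoss Pξ F) α w₁ - smooth (expLoss Pξ F) α w ≤ Δ) →
      ∀ gradF : Vec d → Vec p → Vec d,
      (m = Setting.firstOrder → IsGradVersion Pξ F β α gradF) →
      ∀ proj : ℕ → Vec d → Vec d, (∀ j, IsProjSelection (S ∩ linfBall d β) (proj j)) →
      IsExpectedStationary₃₄ (expLoss Pξ F) α S β ε₃ ε₄ (seedLaw d α Pξ K M)
        (fun seed => (run m F gradF proj α (stepSize d ρ L₀ α) w₁ seed).point)) ∧
    -- its cost
    (∀ b : ℝ, 0 < b → ∃ c : ℝ, ∀ ε₃ ∈ Set.Ioc 0 b, ∀ ε₄ ∈ Set.Ioc 0 b, ∀ (α : ℝ) (K M : ℕ),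
      α = 2 * ε₃ / √d →
      K = ⌈C₁ ρ * (2 * d * L₀ * Δ / (ε₃ * ε₄ ^ 2))⌉₊ →
      M = ⌈C₂ ρ * (2 * m.upsilon d * Q / ε₄ ^ 2)⌉₊ →
      ∀ (gradF : Vec d → Vec p → Vec d) (proj : ℕ → Vec d → Vec d) (seed : Seed d p K M),
      ((run m F gradF proj α (stepSize d ρ L₀ α) w₁ seed).gradCalls : ℝ)
        ≤ c * (ε₃⁻¹ * ε₄⁻¹ ^ 4) ∧
      ((run m F gradF proj α (stepSize d ρ L₀ α) w₁ seed).projections : ℝ)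
        ≤ c * (ε₃⁻¹ * ε₄⁻¹ ^ 2)) := by
  have hd' : (0 : ℝ) < d := by exact_mod_cast hd
  have hsd : 0 < √(d : ℝ) := Real.sqrt_pos.2 hd'
  have hυ := upsilon_pos hd m
  have hQ0 : 0 < Q := by
    have := sq_integral_le_integral_sq hF
    rw [← hL₀, ← hQ] at this
    exact (by positivity : 0 < L₀ ^ 2).trans_le this
  have hC₁ := C₁_pos hρ
  have hC₂ := C₂_pos hρ
  have hC : ((L₀.toNNReal : NNReal) : ℝ) = L₀ := Real.coe_toNNReal _ hL₀_pos.le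
  -- A globally Lipschitz extension of the expected loss from the ball of radius `κ`, with the same
  -- constant.
  obtain ⟨f, hf, hfF⟩ := hF.lipschitzOnWith_expLoss.extend_real
  rw [← hL₀] at hf
  have hMε : ∀ ε : ℝ, 0 < ε → ∀ M : ℕ, M = ⌈C₂ ρ * (2 * m.upsilon d * Q / ε ^ 2)⌉₊ →
      C₂ ρ * (m.upsilon d * Q) ≤ M * (ε ^ 2 / 2) := by
    intro ε hε M hM
    calc _ = C₂ ρ * (2 * m.upsilon d * Q / ε ^ 2) * (ε ^ 2 / 2) := by field_simp
      _ ≤ _ := by gcongr; rw [hM]; exact Nat.le_ceil _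
  refine ⟨?_, ?_, ?_, ?_⟩
  · intro ε₁ ε₂ hε₁ hε₂ α K M hα hK hM hκ hΔ' gradF hgrad proj hproj
    have h12 : 0 < √((d : ℝ) / 12) := Real.sqrt_pos.2 (by positivity)
    have hα0 : 0 < α := by rw [hα]; positivity
    obtain ⟨δ, hδ, hδκ⟩ := exists_margin hκ
    have hKε : C₁ ρ * (2 * √d * L₀ / α * Δ) ≤ K * (ε₂ ^ 2 / 2) := by
      have h1 : √((d : ℝ) / 12) = √d * √(1 / 12) := by
        rw [← Real.sqrt_mul hd'.le, mul_one_div]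
      -- The factor `√(4/3)` is `4 * √(1/12)`: one `2` comes from the Lipschitz constant of the
      -- gradient, the other from the `1/2` in `ε₂² / 2`.
      have h2 : √(4 / 3 : ℝ) = 4 * √(1 / 12) := by
        rw [show (4 / 3 : ℝ) = 4 ^ 2 * (1 / 12) by norm_num, Real.sqrt_mul (by norm_num),
          Real.sqrt_sq (by norm_num)]
      have h3 : (√d : ℝ) * √d = d := Real.mul_self_sqrt hd'.le
      calc _ = C₁ ρ * √(4 / 3) * (d * L₀ ^ 2 * Δ / (ε₁ * ε₂ ^ 2)) * (ε₂ ^ 2 / 2) := by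
            rw [hα, h1, h2]
            nth_rewrite 3 [← h3]
            field_simp
            ring
        _ ≤ _ := by gcongr; rw [hK]; exact Nat.le_ceil _
    obtain ⟨hmem, hmeas, hint⟩ := run_point_spec hd hα0 hδ hδκ hF hgrad hQ hL₀_pos hQ0 hf hfF hS hw₁
      hρ hΔ hε₂ hΔ' hproj hKε (hMε ε₂ hε₂ M hM)
    have heq : ∀ x ∈ linfBall d β, smooth (expLoss Pξ F) α =ᶠ[𝓝 x] smooth f α := fun x hx =>
      smooth_eventuallyEq hδ hδκ hfF hx
    have hset : ∀ seed : Seed d p K M, ∇ (smooth (expLoss Pξ F) α)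
        (run m F gradF proj α (stepSize d ρ L₀ α) w₁ seed).point = ∇ (smooth f α)
        (run m F gradF proj α (stepSize d ρ L₀ α) w₁ seed).point := fun seed => by
      rw [gradient, gradient, (heq _ (hmem seed).2).fderiv_eq]
    refine ⟨fun x hx => ?_, fun x hx => ?_, ?_, ?_⟩
    · have hxκ : x ∈ linfBall d κ := linfBall_mono (le_self_add.trans (le_self_add.trans hδκ)) hx
      rw [(heq x hx).eq_of_nhds, hfF hxκ]
      refine (abs_smooth_sub_le hf hα0 hd x).trans_eq ?_
      rw [hC, hα]
      field_simp
    · exact (hasFDerivAt_smooth hf hα0 x).2.differentiableAt.congr_of_eventuallyEq (heq x hx)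
    · simp only [hset]
      have hG : Continuous (∇ (smooth f α)) :=
        (LipschitzWith.of_dist_le_mul (K := (2 * √d * L₀.toNNReal / α).toNNReal) fun x y => by
          rw [dist_eq_norm, dist_eq_norm, Real.coe_toNNReal _ (by positivity)]
          exact norm_gradient_smooth_sub_le hf hα0 x y).continuous
      have hm := measurable_infEDist_add_normalCone
        (A := fun w => {∇ (smooth f α) w}) (hS.inter (isClosed_linfBall d β))
        fun x a w hx _ ha => ⟨_, rfl, id, strictMono_id, by
          have : a = ∇ (smooth f α) ∘ x := funext fun k => ha k
          rw [this]
          exact (hG.tendsto w).comp hx⟩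
      exact hm.comp_aemeasurable hmeas
    · simp only [hset]
      exact hint
  · intro b hb
    obtain ⟨c, hc⟩ := exists_cost_bound (A := C₁ ρ * √(4 / 3) * (d * L₀ ^ 2 * Δ))
      (B := C₂ ρ * (2 * m.upsilon d * Q)) (by positivity) (by positivity) hb
    refine ⟨c, fun ε₁ hε₁ ε₂ hε₂ α K M _ hK hM gradF proj seed => ?_⟩
    rw [← mul_div_assoc] at hK hM
    exact hc ε₁ hε₁ ε₂ hε₂ K M hK hM m F gradF proj α _ w₁ seed
  · intro ε₃ ε₄ hε₃ hε₄ α K M hα hK hM hκ hΔ' gradF hgrad proj hproj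
    have hα0 : 0 < α := by rw [hα]; positivity
    have hrad : √d * (α / 2) = ε₃ := by rw [hα]; field_simp
    have hαε : α / 2 ≤ ε₃ := by
      rw [← hrad]
      refine le_mul_of_one_le_left (by positivity) (Real.one_le_sqrt.2 ?_)
      exact_mod_cast hd
    obtain ⟨δ, hδ, hδκ'⟩ := exists_margin hκ
    have hδκ : β + ENNReal.ofReal (α / 2) + ENNReal.ofReal δ ≤ κ := by
      refine le_trans ?_ hδκ'
      gcongr
    have hKε : C₁ ρ * (2 * √d * L₀ / α * Δ) ≤ K * (ε₄ ^ 2 / 2) := by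
      have h3 : (√d : ℝ) * √d = d := Real.mul_self_sqrt hd'.le
      calc _ = C₁ ρ * (2 * d * L₀ * Δ / (ε₃ * ε₄ ^ 2)) * (ε₄ ^ 2 / 2) := by
            rw [hα]
            nth_rewrite 3 [← h3]
            field_simp
        _ ≤ _ := by gcongr; rw [hK]; exact Nat.le_ceil _
    obtain ⟨hmem, hmeas, hint⟩ := run_point_spec hd hα0 hδ hδκ hF hgrad hQ hL₀_pos hQ0 hf hfF hS hw₁
      hρ hΔ hε₄ hΔ' hproj hKε (hMε ε₄ hε₄ M hM)
    have hset : ∀ seed : Seed d p K M, clarkeEpsSubdiff (expLoss Pξ F) (√d * (α / 2))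
        (run m F gradF proj α (stepSize d ρ L₀ α) w₁ seed).point = clarkeEpsSubdiff f (√d * (α / 2))
        (run m F gradF proj α (stepSize d ρ L₀ α) w₁ seed).point := fun seed => by
      -- The Clarke `ε`-subdifferential sees `f` near all points within Euclidean distance `ε₃` of
      -- the iterate; this uses the full margin `κ > β + ε₃` instead of `κ > β + α / 2`.
      refine clarkeEpsSubdiff_congr fun x hx => ?_
      rw [hrad, Metric.mem_closedBall, dist_eq_norm] at hx
      filter_upwards [Metric.closedBall_mem_nhds x hδ] with y hy
      rw [Metric.mem_closedBall, dist_eq_norm] at hy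
      refine hfF ?_
      set w := (run m F gradF proj α (stepSize d ρ L₀ α) w₁ seed).point
      have hyw : y = (w + (y - x)) + (x - w) := by abel
      rw [hyw]
      exact add_mem_linfBall hδκ' (hmem seed).2 (by rwa [add_sub_cancel_left])
        (closedBall_subset_linfBall d hx)
    refine ⟨hrad.le, ?_, ?_⟩
    · simp only [hset]
      have hm := measurable_infEDist_add_normalCone
        (A := clarkeEpsSubdiff f (√d * (α / 2))) (hS.inter (isClosed_linfBall d β))
        fun x a w hx _ ha => exists_tendsto_subseq_clarkeEpsSubdiff hf hx ha
      exact hm.comp_aemeasurable hmeas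
    · simp only [hset]
      -- Enlarging the singleton gradient to the Clarke `ε`-subdifferential can only decrease the
      -- distance.
      refine le_trans (lintegral_mono fun seed => Metric.infEDist_anti (Set.add_subset_add_right ?_))
        hint
      exact singleton_subset_iff.2 (gradient_smooth_mem_clarkeEpsSubdiff hf hα0 _)
  · intro b hb
    obtain ⟨c, hc⟩ := exists_cost_bound (A := C₁ ρ * (2 * d * L₀ * Δ))
      (B := C₂ ρ * (2 * m.upsilon d * Q)) (by positivity) (by positivity) hb
    refine ⟨c, fun ε₃ hε₃ ε₄ hε₄ α K M _ hK hM gradF proj seed => ?_⟩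
    rw [← mul_div_assoc] at hK hM
    exact hc ε₃ hε₃ ε₄ hε₄ K M hK hM m F gradF proj α _ w₁ seed
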